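/- **Notation.** For a set $A$ of natural numbers, $A(k)$ is its $k$-th smallest element. A family $\mathcal R$ of finite subsets of $\mathbb N$ is *regular* if it is compact (as a subset of $\{0,1\}^{\mathbb N}$), hereditary (closed under subsets) and spreading ($s\in\mathcal R$, $|t|=|s|$ and $s(i)\le t(i)$ for all $i\le |s|$ imply $t\in\mathcal R$); its order is the rank of $\mathcal R$ ordered by reverse inclusion (maximal elements having rank $0$; this is the rank of $\emptyset$). A *regular thin family of order $\xi$* is the set $\mathcal F$ of $\subseteq$-maximal elements of a regular family of order $\xi$; put $\widehat{\mathcal F}=\{s:\exists t\in\mathcal F,\ s\subseteq t\}$ and $\mathcal G\upharpoonright L=\{s\in\mathcal G: s\subseteq L\}$ for every family $\mathcal G$ of finite subsets of $\mathbb N$ (in particular for $\mathcal G=\mathcal F,\widehat{\mathcal F}$) and every infinite $L\subseteq\mathbb N$. Nonempty finite sets $s_1,\dots,s_l$ form a *plegma family* if $s_i(k)<s_j(k)$ whenever $i<j$ and $k\le\min(|s_i|,|s_j|)$, and $s_i(k)<s_j(k+1)$ for all $i,j$ and $k\le\min(|s_i|,|s_j|-1)$. Let $X$ be a real Banach space,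 $(x_s)_{s\in\mathcal F}$ a family in $X$, $L\subseteq\mathbb N$ infinite, and $(e_n)_{n\ge1}$ a Hamel basis of a real seminormed space. The subsequence $(x_s)_{s\in\mathcal F\upharpoonright L}$ *generates* $(e_n)$ if there are positive reals $\delta_l\to0$ such that $$\Big|\,\big\|\sum_{j=1}^k a_jx_{s_j}\big\|-\big\|\sum_{j=1}^k a_je_j\big\|\,\Big|\le\delta_l$$ whenever $1\le k\le l$, $a_j\in[-1,1]$ and $s_1,\dots,s_k\in\mathcal F\upharpoonright L$ is a plegma family with $\min s_1\ge L(l)$. It is *weakly null* if for all $x^*\in X^*$ and $\varepsilon>0$ there is $n_0$ with $|x^*(x_s)|<\varepsilon$ for all $s\in\mathcal F\upharpoonright L$ with $\min s\ge n_0$. It is *subordinated* if $s\mapsto x_s$ extends to a map $\widehat{\mathcal F}\upharpoonright L\to X$ that is continuous from the topology of $\{0,1\}^{\mathbb N}$ to the weak topology of $X$. $SM_\xi^w(X)$ is the collection of all $(e_n)$ generated by a subordinated weakly null $(x_s)_{s\in\mathcal F\upharpoonright L}$ for some regular thin family $\mathcal F$ of order $\xi$ and some infinite $L$. A sequence is *normalized*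 if all its terms have (semi)norm $1$, and $(u_n)$ *$C$-dominates* $(v_n)$ if $\|\sum_{j=1}^n a_jv_j\|\le C\|\sum_{j=1}^n a_ju_j\|$ for all $n$ and all real $a_1,\dots,a_n$. **Theorem 19.** Let $X$ be a real Banach space and $1\le\xi<\omega_1$. Let $(c_k)_{k\ge1}$ be positive reals with $\sum_{k=1}^\infty c_k^{-1}<\infty$, and for every $k$ let $(e^k_n)_n$ be a normalized sequence that belongs to $SM_\xi^w(X)$. Then there exist $(e_n)_n$ in $SM_\xi^w(X)$ and a real $K$ with $\max_k c_k^{-1}\le K\le\sum_{k=1}^\infty c_k^{-1}$ such that: (i) $(e_n)_n$ is normalized; (ii) $(e_n)_n$ $(c_kK)$-dominates $(e^k_n)_n$ for every $k$; (iii) for every $l$ and all real $a_1,\dots,a_l$, the series $\sum_k c_k^{-1}\|\sum_{j=1}^l a_je^k_j\|$ converges and $$\Big\|\sum_{j=1}^l a_je_j\Big\|\le K^{-1}\sum_{k=1}^\infty c_k^{-1}\Big\|\sum_{j=1}^l a_je^k_j\Big\|.$$ -/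

import Mathlib

open Filter Topology

namespace HigherOrderSM

/-- `elt A k` is the `(k+1)`-st smallest element of `A`, so that `elt A 0 < elt A 1 < ...`
enumerate `A`.  For finite `A` it is only used for `k < |A|`. -/
noncomputable def elt (A : Set ℕ) (k : ℕ) : ℕ := Nat.nth (fun n => n ∈ A) k

/-- The characteristic function of a finite set, as a point of `{0,1}^ℕ`. -/
def charFun (s : Finset ℕ) : ℕ → Bool := fun n => decide (n ∈ s)

/-- The topology on finite sets of natural numbers obtained by identifying a set with its
characteristic function in `{0,1}^ℕ` (product topology). -/
@[reducible] def finsetTopology : TopologicalSpace (Finset ℕ) :=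
  TopologicalSpace.induced charFun inferInstance

/-- Regular families of finite subsets of `ℕ`: compact, hereditary and spreading. -/
structure IsRegular (R : Set (Finset ℕ)) : Prop where
  compact : IsCompact (charFun '' R)
  hereditary : ∀ s ∈ R, ∀ t, t ⊆ s → t ∈ R
  spreading : ∀ s ∈ R, ∀ t : Finset ℕ, t.card = s.card →
    (∀ i < s.card, elt (s : Set ℕ) i ≤ elt (t : Set ℕ) i) → t ∈ R

/-- By compactness, a regular family is well founded under reverse inclusion. -/
theorem IsRegular.wellFounded {R : Set (Finset ℕ)} (hR : IsRegular R) :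
    WellFounded (fun s t : R => t.1 ⊂ s.1) := by
  rw [wellFounded_iff_isEmpty_descending_chain]
  refine ⟨fun ⟨f, hf⟩ => ?_⟩
  have hmono : StrictMono (fun n => (f n).1) := strictMono_nat_of_lt_succ hf
  classical
  let U : ℕ → Bool := fun n => decide (∃ m, n ∈ (f m).1)
  have hlim : Tendsto (fun m => charFun (f m).1) atTop (𝓝 U) := by
    rw [tendsto_pi_nhds]
    intro n
    apply tendsto_nhds_of_eventually_eq
    by_cases h : ∃ m, n ∈ (f m).1
    · obtain ⟨m, hm⟩ := h
      filter_upwards [eventually_ge_atTop m] with k hk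
      have h1 : n ∈ (f k).1 := hmono.monotone hk hm
      have h2 : ∃ m, n ∈ (f m).1 := ⟨m, hm⟩
      simp only [charFun, U, h1, h2, decide_true]
    · refine Eventually.of_forall fun k => ?_
      have h1 : n ∉ (f k).1 := fun h' => h ⟨k, h'⟩
      simp only [charFun, U, h1, h, decide_false]
  have hU : U ∈ charFun '' R :=
    hR.compact.isClosed.mem_of_tendsto hlim
      (Eventually.of_forall fun m => ⟨(f m).1, (f m).2, rfl⟩)
  obtain ⟨s, -, hs⟩ := hU
  have hsub : ∀ m, (f m).1 ⊆ s := by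
    intro m n hn
    have h1 := congrFun hs n
    have h2 : ∃ m, n ∈ (f m).1 := ⟨m, hn⟩
    simpa only [charFun, U, h2, decide_true, decide_eq_true_eq] using h1
  have hcard : StrictMono (fun m => (f m).1.card) :=
    fun a b hab => Finset.card_lt_card (hmono hab)
  have h1 := hcard.le_apply (x := s.card + 1)
  have h2 := Finset.card_le_card (hsub (s.card + 1))
  omega

/-- The order of a regular family: its rank as a partially ordered set under reverse inclusion.
Maximal elements have rank `0`, and a general `s` has the least rank above the ranks of its proper
supersets in `R`.  The supremum is attained at `∅` if `R` is nonempty, so that for example the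
family of all sets with at most `k` elements has order `k`. -/
noncomputable def IsRegular.order {R : Set (Finset ℕ)} (hR : IsRegular R) : Ordinal.{0} :=
  ⨆ s : R, (hR.wellFounded.apply s).rank

/-- `F` is a regular thin family of order `ξ`: it consists of the maximal elements, under
inclusion, of a regular family of order `ξ`. -/
def IsRegularThinOfOrder (F : Set (Finset ℕ)) (ξ : Ordinal.{0}) : Prop :=
  ∃ (R : Set (Finset ℕ)) (hR : IsRegular R),
    F = {s | Maximal (fun t => t ∈ R) s} ∧ hR.order = ξ

/-- The closure of `F`: all subsets of elements of `F`. -/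
def hat (F : Set (Finset ℕ)) : Set (Finset ℕ) := {s | ∃ t ∈ F, s ⊆ t}

/-- The restriction of the family `F` to `L`: the elements of `F` contained in `L`. -/
def restr (F : Set (Finset ℕ)) (L : Set ℕ) : Set (Finset ℕ) := {s | s ∈ F ∧ (s : Set ℕ) ⊆ L}

/-- Plegma families. -/
structure IsPlegma {l : ℕ} (s : Fin l → Finset ℕ) : Prop where
  nonempty : ∀ i, (s i).Nonempty
  lt_same : ∀ i j, i < j → ∀ k, k < (s i).card → k < (s j).card →
    elt (s i : Set ℕ) k < elt (s j : Set ℕ) k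
  lt_succ : ∀ i j, ∀ k, k < (s i).card → k + 1 < (s j).card →
    elt (s i : Set ℕ) k < elt (s j : Set ℕ) (k + 1)

section Sequences

variable {X : Type*} [NormedAddCommGroup X] [NormedSpace ℝ X]

/-- The `F`-subsequence `(x_s)`, `s ∈ F ↾ M`, generates the Hamel basis `(e_n)` of the seminormed
space `E` as an `F`-spreading model with respect to `(δ_n)`.  All sequences are indexed from `0`,
so the length of the plegma family is `k + 1 ≤ l + 1` and `elt M l` is the `(l+1)`-st element
of `M`. -/
def GeneratesWrt (F : Set (Finset ℕ)) (x : Finset ℕ → X) (M : Set ℕ)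
    {E : Type*} [SeminormedAddCommGroup E] [NormedSpace ℝ E] (e : Module.Basis ℕ ℝ E)
    (δ : ℕ → ℝ) : Prop :=
  ∀ l k : ℕ, k ≤ l → ∀ a : Fin (k + 1) → ℝ, (∀ j, a j ∈ Set.Icc (-1 : ℝ) 1) →
    ∀ s : Fin (k + 1) → Finset ℕ, (∀ j, s j ∈ restr F M) → IsPlegma s →
      elt M l ≤ elt (s 0 : Set ℕ) 0 →
        |‖∑ j, a j • x (s j)‖ - ‖∑ j : Fin (k + 1), a j • e (j : ℕ)‖| ≤ δ l

/-- The `F`-subsequence `(x_s)`, `s ∈ F ↾ M`, generates `(e_n)` as an `F`-spreading model. -/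
def Generates (F : Set (Finset ℕ)) (x : Finset ℕ → X) (M : Set ℕ)
    {E : Type*} [SeminormedAddCommGroup E] [NormedSpace ℝ E] (e : Module.Basis ℕ ℝ E) : Prop :=
  ∃ δ : ℕ → ℝ, (∀ n, 0 < δ n) ∧ Tendsto δ atTop (𝓝 0) ∧ GeneratesWrt F x M e δ

/-- The `F`-subsequence `(x_s)`, `s ∈ F ↾ L`, is weakly null. -/
def IsWeaklyNull (F : Set (Finset ℕ)) (x : Finset ℕ → X) (L : Set ℕ) : Prop :=
  ∀ f : X →L[ℝ] ℝ, ∀ ε > 0, ∃ n₀ : ℕ, ∀ s ∈ restr F L, (∀ n ∈ s, n₀ ≤ n) → |f (x s)| < ε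

/-- The `F`-subsequence `(x_s)`, `s ∈ F ↾ L`, is subordinated: it extends to a map on the
restriction to `L` of the closure of `F` that is continuous for the weak topology of `X`. -/
def IsSubordinated (F : Set (Finset ℕ)) (x : Finset ℕ → X) (L : Set ℕ) : Prop :=
  ∃ φ : Finset ℕ → X,
    @ContinuousOn _ _ finsetTopology _ (fun s => toWeakSpace ℝ X (φ s)) (restr (hat F) L) ∧
    ∀ s ∈ restr F L, x s = φ s

end Sequences

/-- `(e_n)`, the Hamel basis of a seminormed space `E`, belongs to `SM_ξ^w(X)`: it is a `ξ`-order
spreading model generated by a subordinated weakly null `F`-subsequence in `X`, for some regular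
thin family `F` of order `ξ`.  An `F`-sequence is given by a function on all finite sets, whose
values off `F` play no role. -/
def MemSM (ξ : Ordinal.{0}) (X : Type*) [NormedAddCommGroup X] [NormedSpace ℝ X]
    {E : Type*} [SeminormedAddCommGroup E] [NormedSpace ℝ E] (e : Module.Basis ℕ ℝ E) : Prop :=
  ∃ (F : Set (Finset ℕ)) (x : Finset ℕ → X) (L : Set ℕ),
    IsRegularThinOfOrder F ξ ∧ L.Infinite ∧
      IsSubordinated F x L ∧ IsWeaklyNull F x L ∧ Generates F x L e

/-- `(u_n)` `C`-dominates `(v_n)`. -/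
def Dominates (C : ℝ) {E E' : Type*} [SeminormedAddCommGroup E] [NormedSpace ℝ E]
    [SeminormedAddCommGroup E'] [NormedSpace ℝ E'] (u : ℕ → E) (v : ℕ → E') : Prop :=
  ∀ (n : ℕ) (a : Fin n → ℝ),
    ‖∑ j : Fin n, a j • v (j : ℕ)‖ ≤ C * ‖∑ j : Fin n, a j • u (j : ℕ)‖

end HigherOrderSM

namespace HigherOrderSM

/-! ### Enumerations of finite sets -/

/-! Put `d k = (c k)⁻¹`. The new spreading model comes from one family that adds up the given ones:
roughly, the vector at `t` is the sum of `d k • φ_k(t_k)` over `k < min t`, where `φ_k` is the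
`k`-th family and `t_k` a far-out copy of an initial segment of `t`. The triangle inequality gives
the upper estimate. The lower estimate says that the `k`-th summands alone are asymptotically no
longer than the whole sum. Dividing by the norm `K` of the first basis vector normalizes the result,
and the two estimates for a single vector give the bounds on `K`.

Each given family becomes a weakly continuous map on a tree of finite sets (`WeakSystem`,
`MemSM.exists_weakSystem`). It vanishes at `∅`, because the family is weakly null, and an increasing
sequence `p` selects the terminal node `top p`. An array of vectors, one per residue class, is then
read off a single increasing sequence (`arraySum`). Since it depends on finitely many terms of the
sequence, an ultrafilter form of the Ramsey theorem (`exists_strictMono_asymptotically_const`) makes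
the norms of all such combinations asymptotically independent of the sequence (`exists_stable`).

Consequently a lower bound need only be verified on one array, far enough out. In
`exists_suppression` the wanted vectors are fixed first, a functional norming their combination is
taken, and the remaining branches are chosen so that this functional nearly vanishes on them.
Weak-star compactness of the dual ball (`exists_blocks`) confines the choices to blocks of integers
fixed before the functional, so all branches fit into one sequence.

To apply stability to the sums, the copies `t_k` of a plegma family must jointly be the strands of
one sequence. The maps `spreadMap k` achieve this by interlacing with large gaps
(`exists_array_top`). Finally all trees must live on one regular thin family of order `ξ`:
comparison of ranks (`exists_sparse_image_mem`) embeds them, up to finitely many coordinates, in a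
given regular family, so that each of its maximal sets contains a terminal node of every relevant
tree. -/

theorem elt_eq_of_card_filter {s : Finset ℕ} {m k : ℕ} (hm : m ∈ s)
    (hk : (s.filter (· < m)).card = k) : elt (s : Set ℕ) k = m := by
  classical
  have h1 : Nat.count (fun n => n ∈ (s : Set ℕ)) m = k := by
    rw [Nat.count_eq_card_filter_range, ← hk]
    congr 1
    ext a
    simp [and_comm]
  rw [elt, ← h1]
  exact Nat.nth_count (by simpa using hm)

theorem elt_mem {s : Finset ℕ} {k : ℕ} (hk : k < s.card) : elt (s : Set ℕ) k ∈ s := by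
  have := Nat.nth_mem (p := fun n => n ∈ (s : Set ℕ)) k (fun hf => by
    have : hf.toFinset = s := by ext; simp
    rwa [this])
  simpa [elt] using this

theorem card_filter_lt_elt {s : Finset ℕ} {k : ℕ} (hk : k < s.card) :
    (s.filter (· < elt (s : Set ℕ) k)).card = k := by
  classical
  have := Nat.count_nth (p := fun n => n ∈ (s : Set ℕ)) (n := k) (fun hf => by
    have : hf.toFinset = s := by ext; simp
    rwa [this])
  rw [Nat.count_eq_card_filter_range] at this
  conv_rhs => rw [← this]
  congr 1
  ext a
  simp [elt, and_comm]

theorem elt_lt_elt {s : Finset ℕ} {j k : ℕ} (hjk : j < k) (hk : k < s.card) :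
    elt (s : Set ℕ) j < elt (s : Set ℕ) k := by
  by_contra! h
  have h1 := card_filter_lt_elt hk
  have h2 := card_filter_lt_elt (hjk.trans hk)
  have h3 : s.filter (· < elt (s : Set ℕ) k) ⊆ s.filter (· < elt (s : Set ℕ) j) :=
    Finset.monotone_filter_right _ (fun a _ ha => lt_of_lt_of_le ha h)
  have := Finset.card_le_card h3
  omega

theorem exists_elt_eq {s : Finset ℕ} {m : ℕ} (hm : m ∈ s) :
    ∃ k < s.card, elt (s : Set ℕ) k = m := by
  refine ⟨(s.filter (· < m)).card, ?_, elt_eq_of_card_filter hm rfl⟩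
  apply Finset.card_lt_card
  refine ⟨Finset.filter_subset _ _, fun h => ?_⟩
  simpa using h hm

/-- Spreading is handled through counting functions, which behave better than enumerations under
unions and insertions. -/
theorem elt_le_elt_of_card_filter_le {s t : Finset ℕ} (hcard : t.card = s.card)
    (h : ∀ m, (t.filter (· < m)).card ≤ (s.filter (· < m)).card) {i : ℕ} (hi : i < s.card) :
    elt (s : Set ℕ) i ≤ elt (t : Set ℕ) i := by
  by_contra! hlt
  have h1 := card_filter_lt_elt hi
  have h2 := card_filter_lt_elt (hcard ▸ hi : i < t.card)
  have h3 := h (elt (s : Set ℕ) i)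
  have h4 : t.filter (· < elt (t : Set ℕ) i) ⊂ t.filter (· < elt (s : Set ℕ) i) := by
    refine ⟨Finset.monotone_filter_right _ (fun a _ ha => lt_trans ha hlt), fun h => ?_⟩
    have := h (Finset.mem_filter.2 ⟨elt_mem (hcard ▸ hi : i < t.card), hlt⟩)
    simp at this
  have := Finset.card_lt_card h4
  omega

theorem elt_image {h : ℕ → ℕ} (hh : StrictMono h) {s : Finset ℕ} {k : ℕ} (hk : k < s.card) :
    elt ((s.image h : Finset ℕ) : Set ℕ) k = h (elt (s : Set ℕ) k) := by
  apply elt_eq_of_card_filter (Finset.mem_image_of_mem _ (elt_mem hk))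
  have : (s.image h).filter (· < h (elt (s : Set ℕ) k)) =
      (s.filter (· < elt (s : Set ℕ) k)).image h := by
    ext a
    simp only [Finset.mem_filter, Finset.mem_image]
    constructor
    · rintro ⟨⟨b, hb, rfl⟩, h2⟩
      exact ⟨b, ⟨hb, hh.lt_iff_lt.1 h2⟩, rfl⟩
    · rintro ⟨b, ⟨hb, h2⟩, rfl⟩
      exact ⟨⟨b, hb, rfl⟩, hh h2⟩
  rw [this, Finset.card_image_of_injective _ hh.injective, card_filter_lt_elt hk]

theorem elt_eq_elt_of_initial {s t : Finset ℕ} (hst : s ⊆ t)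
    (hinit : ∀ a ∈ s, ∀ b ∈ t, b ≤ a → b ∈ s) {k : ℕ} (hk : k < s.card) :
    elt (t : Set ℕ) k = elt (s : Set ℕ) k := by
  apply elt_eq_of_card_filter (hst (elt_mem hk))
  refine Eq.trans ?_ (card_filter_lt_elt hk)
  congr 1
  ext a
  simp only [Finset.mem_filter]
  exact ⟨fun h => ⟨hinit _ (elt_mem hk) a h.1 h.2.le, h.2⟩, fun h => ⟨hst h.1, h.2⟩⟩

/-- The set of the first `n` terms of a sequence. -/
def init (p : ℕ → ℕ) (n : ℕ) : Finset ℕ := (Finset.range n).image p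

theorem mem_init {p : ℕ → ℕ} {n m : ℕ} : m ∈ init p n ↔ ∃ i < n, p i = m := by
  simp [init]

@[simp] theorem init_zero (p : ℕ → ℕ) : init p 0 = ∅ := by simp [init]

theorem init_succ (p : ℕ → ℕ) (n : ℕ) : init p (n + 1) = insert (p n) (init p n) := by
  simp [init, Finset.range_add_one]

theorem init_mono (p : ℕ → ℕ) : Monotone (init p) := fun _ _ h =>
  Finset.image_subset_image (Finset.range_mono h)

theorem card_init {p : ℕ → ℕ} (hp : StrictMono p) (n : ℕ) : (init p n).card = n := by
  rw [init, Finset.card_image_of_injective _ hp.injective, Finset.card_range]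

theorem lt_of_mem_init {p : ℕ → ℕ} (hp : StrictMono p) {n m : ℕ} (hm : m ∈ init p n) :
    m < p n := by
  obtain ⟨i, hi, rfl⟩ := mem_init.1 hm
  exact hp hi

theorem init_congr {p p' : ℕ → ℕ} {n : ℕ} (h : ∀ i < n, p i = p' i) : init p n = init p' n :=
  Finset.image_congr fun i hi => h i (by simpa using hi)

theorem image_init (h p : ℕ → ℕ) (n : ℕ) : (init p n).image h = init (h ∘ p) n := by
  simp [init, Finset.image_image]

theorem elt_init {p : ℕ → ℕ} (hp : StrictMono p) {n k : ℕ} (hk : k < n) :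
    elt (init p n : Set ℕ) k = p k := by
  apply elt_eq_of_card_filter (mem_init.2 ⟨k, hk, rfl⟩)
  have : (init p n).filter (· < p k) = init p k := by
    ext a
    simp only [Finset.mem_filter, mem_init]
    constructor
    · rintro ⟨⟨i, hi, rfl⟩, h2⟩
      exact ⟨i, hp.lt_iff_lt.1 h2, rfl⟩
    · rintro ⟨i, hi, rfl⟩
      exact ⟨⟨i, hi.trans hk, rfl⟩, hp hi⟩
  rw [this, card_init hp]

theorem init_eq_of_elt {s : Finset ℕ} {p : ℕ → ℕ} (h : ∀ i < s.card, p i = elt (s : Set ℕ) i) :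
    init p s.card = s := by
  ext m
  rw [mem_init]
  constructor
  · rintro ⟨i, hi, rfl⟩
    rw [h i hi]
    exact elt_mem hi
  · intro hm
    obtain ⟨k, hk, rfl⟩ := exists_elt_eq hm
    exact ⟨k, hk, h k hk⟩

theorem elt_range {p : ℕ → ℕ} (hp : StrictMono p) (k : ℕ) : elt (Set.range p) k = p k := by
  have h0 : {n | n ∈ Set.range p}.Infinite := Set.infinite_range_of_injective hp.injective
  have := Nat.nth_comp_of_strictMono (p := fun n => n ∈ Set.range p) (n := k) hp
    (fun a ha => ha) (fun hf => absurd hf h0)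
  rw [elt, ← this]
  simp

/-! ### Plegma families -/

theorem IsPlegma.comp {l m : ℕ} {s : Fin l → Finset ℕ} (hs : IsPlegma s) {g : Fin m → Fin l}
    (hg : StrictMono g) : IsPlegma (s ∘ g) where
  nonempty _ := hs.nonempty _
  lt_same _ _ hij := hs.lt_same _ _ (hg hij)
  lt_succ _ _ := hs.lt_succ _ _

theorem isPlegma_image_iff {l : ℕ} {s : Fin l → Finset ℕ} {h : ℕ → ℕ} (hh : StrictMono h) :
    IsPlegma (fun i => (s i).image h) ↔ IsPlegma s := by
  have hc : ∀ i, ((s i).image h).card = (s i).card := fun i =>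
    Finset.card_image_of_injective _ hh.injective
  constructor
  · intro H
    refine ⟨fun i => by simpa using H.nonempty i, fun i j hij k hi hj => ?_,
      fun i j k hi hj => ?_⟩
    · have := H.lt_same i j hij k (by rwa [hc]) (by rwa [hc])
      rw [elt_image hh hi, elt_image hh hj] at this
      exact hh.lt_iff_lt.1 this
    · have := H.lt_succ i j k (by rwa [hc]) (by rwa [hc])
      rw [elt_image hh hi, elt_image hh hj] at this
      exact hh.lt_iff_lt.1 this
  · intro H
    refine ⟨fun i => by simpa using H.nonempty i, fun i j hij k hi hj => ?_,
      fun i j k hi hj => ?_⟩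
    · rw [hc] at hi hj
      rw [elt_image hh hi, elt_image hh hj]
      exact hh (H.lt_same i j hij k hi hj)
    · rw [hc] at hi hj
      rw [elt_image hh hi, elt_image hh hj]
      exact hh (H.lt_succ i j k hi hj)

theorem isPlegma_init {l : ℕ} {p : Fin l → ℕ → ℕ} {n : Fin l → ℕ} (hp : ∀ i, StrictMono (p i))
    (hn : ∀ i, 0 < n i) (h1 : ∀ i j, i < j → ∀ k, p i k < p j k)
    (h2 : ∀ i j k, p i k < p j (k + 1)) : IsPlegma (fun i => init (p i) (n i)) where
  nonempty i := ⟨p i 0, mem_init.2 ⟨0, hn i, rfl⟩⟩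
  lt_same i j hij k hi hj := by
    rw [card_init (hp i)] at hi
    rw [card_init (hp j)] at hj
    rw [elt_init (hp i) hi, elt_init (hp j) hj]
    exact h1 i j hij k
  lt_succ i j k hi hj := by
    rw [card_init (hp i)] at hi
    rw [card_init (hp j)] at hj
    rw [elt_init (hp i) hi, elt_init (hp j) hj]
    exact h2 i j k

/-! ### Diagonal sequences -/

/-- The common recursion behind all passages to subsequences. Asking for frequent rather than
eventual solutions covers choices inside an infinite set and choices along a nonprincipal
ultrafilter. -/
theorem exists_strictMono_diagonal (Q : ℕ → (ℕ → ℕ) → ℕ → Prop)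
    (hcongr : ∀ j M M' m, (∀ i < j, M i = M' i) → Q j M m → Q j M' m)
    (hex : ∀ j M, ∃ᶠ m in atTop, Q j M m) :
    ∃ M : ℕ → ℕ, StrictMono M ∧ ∀ j, Q j M (M j) := by
  have hex' : ∀ j M, ∃ m, Q j M m ∧ ∀ i < j, M i < m := by
    intro j M
    have : ∀ᶠ m in atTop, ∀ i < j, M i < m := by
      have := (Finset.range j).eventually_all (l := (atTop : Filter ℕ))
        (p := fun i m => M i < m)
      simp only [Finset.mem_range] at this
      exact this.2 fun i _ => eventually_gt_atTop _
    exact ((hex j M).and_eventually this).exists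
  choose F hF1 hF2 using hex'
  -- `G j` carries the first `j` chosen values and zeros afterwards; by `hcongr` the zeros are
  -- invisible to the `j`-th condition.
  let G : ℕ → ℕ → ℕ := fun n => Nat.rec (fun _ => 0) (fun j g => Function.update g j (F j g)) n
  have hG : ∀ j, G (j + 1) = Function.update (G j) j (F j (G j)) := fun j => rfl
  have hGj : ∀ j i, i < j → G j i = F i (G i) := by
    intro j
    induction j with
    | zero => intro i hi; omega
    | succ j ih =>
      intro i hi
      rw [hG]
      rcases Nat.lt_succ_iff_lt_or_eq.1 hi with h | rfl
      · rw [Function.update_of_ne h.ne, ih i h]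
      · simp
  refine ⟨fun j => F j (G j), ?_, fun j => ?_⟩
  · apply strictMono_nat_of_lt_succ
    intro j
    have := hF2 (j + 1) (G (j + 1)) j (Nat.lt_succ_self j)
    rwa [hGj (j + 1) j (Nat.lt_succ_self j)] at this
  · exact hcongr j _ _ _ (fun i hi => hGj j i hi) (hF1 j (G j))

/-! ### Ranks in regular families -/

namespace IsRegular

variable {R : Set (Finset ℕ)}

/-- The rank of a member of a regular family, as a function on all finite sets. -/
noncomputable def rk (hR : IsRegular R) (s : Finset ℕ) : Ordinal.{0} :=
  open Classical in if h : s ∈ R then (hR.wellFounded.apply ⟨s, h⟩).rank else 0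

theorem rk_lt_rk (hR : IsRegular R) {s t : Finset ℕ} (ht : t ∈ R) (hst : s ⊂ t) :
    hR.rk t < hR.rk s := by
  have hs : s ∈ R := hR.hereditary t ht s hst.1
  simp only [rk, hs, ht, dif_pos]
  exact Acc.rank_lt_of_rel (r := fun s t : R => t.1 ⊂ s.1) (hR.wellFounded.apply ⟨s, hs⟩)
    (a := ⟨t, ht⟩) hst

theorem rk_le_rk (hR : IsRegular R) {s t : Finset ℕ} (ht : t ∈ R) (hst : s ⊆ t) :
    hR.rk t ≤ hR.rk s := by
  rcases hst.eq_or_ssubset with rfl | h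
  · exact le_rfl
  · exact (hR.rk_lt_rk ht h).le

theorem exists_of_lt_rk (hR : IsRegular R) {s : Finset ℕ} (hs : s ∈ R) {β : Ordinal.{0}}
    (hβ : β < hR.rk s) : ∃ t ∈ R, s ⊂ t ∧ β ≤ hR.rk t := by
  simp only [rk, hs, dif_pos] at hβ
  rw [Acc.rank_eq, Ordinal.lt_iSup_iff] at hβ
  obtain ⟨⟨⟨t, ht⟩, hst⟩, h⟩ := hβ
  refine ⟨t, ht, hst, ?_⟩
  simp only [rk, ht, dif_pos]
  exact Order.lt_succ_iff.1 h

theorem empty_mem (hR : IsRegular R) (hne : R.Nonempty) : ∅ ∈ R := by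
  obtain ⟨s, hs⟩ := hne
  exact hR.hereditary s hs ∅ (Finset.empty_subset _)

theorem order_eq_rk_empty (hR : IsRegular R) (hne : R.Nonempty) : hR.order = hR.rk ∅ := by
  have h0 := hR.empty_mem hne
  have hle : ∀ s : R, (hR.wellFounded.apply s).rank ≤ hR.rk ∅ := by
    intro s
    have := hR.rk_le_rk s.2 (Finset.empty_subset _)
    simpa only [rk, s.2, dif_pos] using this
  apply le_antisymm
  · exact Ordinal.iSup_le hle
  · have := Ordinal.le_iSup (fun s : R => (hR.wellFounded.apply s).rank) ⟨∅, h0⟩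
    simpa only [rk, h0, dif_pos, order] using this

theorem mem_of_card_filter_le (hR : IsRegular R) {s t : Finset ℕ} (hs : s ∈ R)
    (hcard : t.card = s.card)
    (h : ∀ m, (t.filter (· < m)).card ≤ (s.filter (· < m)).card) : t ∈ R :=
  hR.spreading s hs t hcard fun _ hi => elt_le_elt_of_card_filter_le hcard h hi

/-- Every proper superset of `s` in the family is imitated by a superset of `t` lying further to the
right, so induction along reverse inclusion applies. -/
theorem rk_le_rk_of_spread (hR : IsRegular R) {s : Finset ℕ} (hs : s ∈ R) :
    ∀ {t : Finset ℕ}, t.card = s.card →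
    (∀ m, (t.filter (· < m)).card ≤ (s.filter (· < m)).card) → hR.rk s ≤ hR.rk t := by
  suffices H : ∀ s : R, ∀ t : Finset ℕ, t.card = s.1.card →
      (∀ m, (t.filter (· < m)).card ≤ (s.1.filter (· < m)).card) → hR.rk s.1 ≤ hR.rk t from
    fun {t} h1 h2 => H ⟨s, hs⟩ t h1 h2
  intro s
  induction s using hR.wellFounded.induction with
  | _ s ih =>
  intro t hcard hle
  by_contra! hlt
  obtain ⟨u, hu, hsu, hr⟩ := hR.exists_of_lt_rk s.2 hlt
  obtain ⟨N, hN⟩ : ∃ N, ∀ a ∈ u ∪ t, a < N :=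
    ⟨(u ∪ t).sup id + 1, fun a ha => Nat.lt_succ_of_le (Finset.le_sup (f := id) ha)⟩
  have hcu : s.1.card < u.card := Finset.card_lt_card hsu
  -- Appending `|u| - |s|` points beyond `u ∪ t` places `v` to the right of `u`: up to `N` only `t`
  -- is counted, and beyond `N` all of `u` already is.
  set v := t ∪ Finset.Ico N (N + (u.card - s.1.card)) with hv
  have hdisj : Disjoint t (Finset.Ico N (N + (u.card - s.1.card))) := by
    rw [Finset.disjoint_left]
    intro a ha hb
    have := hN a (Finset.mem_union_right _ ha)
    have := (Finset.mem_Ico.1 hb).1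
    omega
  have hvc : v.card = u.card := by
    rw [hv, Finset.card_union_of_disjoint hdisj, Nat.card_Ico]
    omega
  have hvle : ∀ m, (v.filter (· < m)).card ≤ (u.filter (· < m)).card := by
    intro m
    rcases le_or_gt m N with hm | hm
    · have h1 : v.filter (· < m) ⊆ t.filter (· < m) := by
        intro a ha
        simp only [hv, Finset.mem_filter, Finset.mem_union, Finset.mem_Ico] at ha ⊢
        refine ⟨?_, ha.2⟩
        rcases ha.1 with h | h
        · exact h
        · omega
      exact (Finset.card_le_card h1).trans ((hle m).trans
        (Finset.card_le_card (Finset.filter_subset_filter _ hsu.1)))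
    · have h1 : u.filter (· < m) = u := by
        apply Finset.filter_true_of_mem
        intro a ha
        exact (hN a (Finset.mem_union_left _ ha)).trans hm
      rw [h1, ← hvc]
      exact Finset.card_filter_le _ _
  have hvR : v ∈ R := hR.mem_of_card_filter_le hu hvc hvle
  have h1 := ih ⟨u, hu⟩ hsu v hvc hvle
  have h2 : t ⊂ v := by
    refine ⟨Finset.subset_union_left, fun h => ?_⟩
    have := Finset.card_le_card h
    omega
  exact absurd (hr.trans h1) (not_le.2 (hR.rk_lt_rk hvR h2))

theorem card_filter_insert_le {s : Finset ℕ} {x n : ℕ} (hx : x ∉ s) (hn : n ∉ s) (hxn : x ≤ n)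
    (m : ℕ) : ((insert n s).filter (· < m)).card ≤ ((insert x s).filter (· < m)).card := by
  rw [Finset.filter_insert, Finset.filter_insert]
  split_ifs with h1 h2 h2
  · rw [Finset.card_insert_of_notMem (by simp [hn]), Finset.card_insert_of_notMem (by simp [hx])]
  · omega
  · exact Finset.card_le_card (Finset.subset_insert _ _)
  · exact le_rfl

theorem insert_mem_of_le (hR : IsRegular R) {s : Finset ℕ} {x n : ℕ} (hx : x ∉ s) (hn : n ∉ s)
    (hxn : x ≤ n) (h : insert x s ∈ R) :
    insert n s ∈ R ∧ hR.rk (insert x s) ≤ hR.rk (insert n s) := by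
  have hc : (insert n s).card = (insert x s).card := by
    rw [Finset.card_insert_of_notMem hn, Finset.card_insert_of_notMem hx]
  exact ⟨hR.mem_of_card_filter_le h hc (card_filter_insert_le hx hn hxn),
    hR.rk_le_rk_of_spread h hc (card_filter_insert_le hx hn hxn)⟩

theorem eventually_insert_mem (hR : IsRegular R) {s : Finset ℕ} {x : ℕ} (hx : x ∉ s)
    (h : insert x s ∈ R) : ∀ᶠ n in atTop, insert n s ∈ R := by
  filter_upwards [eventually_ge_atTop x, eventually_gt_atTop (s.sup id)] with n h1 h2
  refine (hR.insert_mem_of_le hx (fun hn => ?_) h1 h).1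
  have := Finset.le_sup (f := id) hn
  simp only [id] at this
  omega

/-- A superset of rank at least `β` contains a new point `x`, and adjoining `x` alone keeps the rank
at least `β`. The point may sit below `max s`; moving it far to the right preserves membership and
does not lower the rank. -/
theorem eventually_le_rk_insert (hR : IsRegular R) {s : Finset ℕ} (hs : s ∈ R) {β : Ordinal.{0}}
    (hβ : β < hR.rk s) : ∀ᶠ n in atTop, insert n s ∈ R ∧ β ≤ hR.rk (insert n s) := by
  obtain ⟨t, ht, hst, h⟩ := hR.exists_of_lt_rk hs hβ
  obtain ⟨x, hxt, hxs⟩ := Finset.exists_of_ssubset hst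
  have hsub : insert x s ⊆ t := Finset.insert_subset hxt hst.1
  have hx : insert x s ∈ R := hR.hereditary t ht _ hsub
  filter_upwards [eventually_ge_atTop x, eventually_gt_atTop (s.sup id)] with n h1 h2
  have hn : n ∉ s := fun hn => by
    have := Finset.le_sup (f := id) hn
    simp only [id] at this
    omega
  obtain ⟨h3, h4⟩ := hR.insert_mem_of_le hxs hn h1 hx
  exact ⟨h3, h.trans ((hR.rk_le_rk ht hsub).trans h4)⟩

theorem maximal_iff (hR : IsRegular R) {s : Finset ℕ} :
    Maximal (fun t => t ∈ R) s ↔ s ∈ R ∧ ∀ x ∉ s, insert x s ∉ R := by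
  constructor
  · intro h
    refine ⟨h.1, fun x hx hins => hx ?_⟩
    exact h.2 hins (Finset.subset_insert _ _) (Finset.mem_insert_self _ _)
  · rintro ⟨h1, h2⟩
    refine ⟨h1, fun t ht hst => ?_⟩
    by_contra hts
    obtain ⟨x, hxt, hxs⟩ := Finset.not_subset.1 hts
    exact h2 x hxs (hR.hereditary t ht _ (Finset.insert_subset hxt hst))

theorem exists_maximal_superset (hR : IsRegular R) {s : Finset ℕ} (hs : s ∈ R) :
    ∃ t, Maximal (fun t => t ∈ R) t ∧ s ⊆ t := by
  obtain ⟨⟨t, ht⟩, hst, hmin⟩ := hR.wellFounded.has_min {t : R | s ⊆ t.1} ⟨⟨s, hs⟩, Finset.Subset.refl s⟩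
  refine ⟨t, hR.maximal_iff.2 ⟨ht, fun x hx hins => ?_⟩, hst⟩
  exact hmin ⟨_, hins⟩ (hst.trans (Finset.subset_insert _ _)) (Finset.ssubset_insert hx)

theorem hat_maximal (hR : IsRegular R) : hat {s | Maximal (fun t => t ∈ R) s} = R := by
  ext s
  constructor
  · rintro ⟨t, ht, hst⟩
    exact hR.hereditary t ht.1 s hst
  · intro hs
    obtain ⟨t, ht, hst⟩ := hR.exists_maximal_superset hs
    exact ⟨t, ht, hst⟩

end IsRegular


/-! ### Well-founded families closed under later one-point extensions -/

/-- A hereditary family of finite sets, containing the singletons and carrying a rank, in which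
the possibility of a later one-point extension does not depend on the point. -/
structure RankedTree where
  /-- the family -/
  R : Set (Finset ℕ)
  /-- the rank -/
  rk : Finset ℕ → Ordinal.{0}
  singleton_mem : ∀ n, {n} ∈ R
  hereditary : ∀ s ∈ R, ∀ t, t ⊆ s → t ∈ R
  extend : ∀ s n m, (∀ a ∈ s, a < n) → (∀ a ∈ s, a < m) → insert n s ∈ R → insert m s ∈ R
  rk_lt : ∀ s n, (∀ a ∈ s, a < n) → insert n s ∈ R → rk (insert n s) < rk s

namespace RankedTree

variable (T : RankedTree)

theorem empty_mem : ∅ ∈ T.R := T.hereditary _ (T.singleton_mem 0) _ (Finset.empty_subset _)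

/-- Members of the family without later one-point extensions in it. -/
def Terminal (s : Finset ℕ) : Prop := s ∈ T.R ∧ ∀ n, (∀ a ∈ s, a < n) → insert n s ∉ T.R

variable {T}

theorem Terminal.nonempty {s : Finset ℕ} (hs : T.Terminal s) : s.Nonempty := by
  rw [Finset.nonempty_iff_ne_empty]
  rintro rfl
  exact hs.2 0 (by simp) (T.singleton_mem 0)

variable (T)

/-- The length of the longest initial segment of a sequence that belongs to the family. -/
noncomputable def cut (p : ℕ → ℕ) : ℕ := sInf {n | init p (n + 1) ∉ T.R}

/-- The longest initial segment of a sequence that belongs to the family. -/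
noncomputable def top (p : ℕ → ℕ) : Finset ℕ := init p (T.cut p)

/-- Otherwise the ranks of the initial segments would descend forever. -/
theorem exists_init_notMem {p : ℕ → ℕ} (hp : StrictMono p) : ∃ n, init p (n + 1) ∉ T.R := by
  by_contra! h
  have hlt : ∀ n, T.rk (init p (n + 1)) < T.rk (init p n) := by
    intro n
    have := h n
    rw [init_succ] at this ⊢
    exact T.rk_lt _ _ (fun a ha => lt_of_mem_init hp ha) this
  exact (wellFounded_iff_isEmpty_descending_chain.1
    (wellFounded_lt (α := Ordinal.{0}))).false ⟨fun n => T.rk (init p n), hlt⟩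

theorem terminal_of_insert_notMem {s : Finset ℕ} (hs : s ∈ T.R) {m : ℕ} (hm : ∀ a ∈ s, a < m)
    (h : insert m s ∉ T.R) : T.Terminal s :=
  ⟨hs, fun n hn hins => h (T.extend s n m hn hm hins)⟩

theorem terminal_top {p : ℕ → ℕ} (hp : StrictMono p) : T.Terminal (T.top p) := by
  have h1 : init p (T.cut p + 1) ∉ T.R := Nat.sInf_mem (T.exists_init_notMem hp)
  have h2 : T.top p ∈ T.R := by
    rw [top]
    rcases Nat.eq_zero_or_pos (T.cut p) with h | h
    · rw [h, init_zero]
      exact T.empty_mem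
    · have := Nat.notMem_of_lt_sInf (show T.cut p - 1 < sInf {n | init p (n + 1) ∉ T.R} from
        Nat.sub_lt h one_pos)
      rw [Set.mem_ofPred_eq, not_not, Nat.sub_add_cancel h] at this
      exact this
  rw [init_succ] at h1
  exact T.terminal_of_insert_notMem h2 (fun a ha => lt_of_mem_init hp ha) h1

theorem cut_eq_of_terminal {p : ℕ → ℕ} (hp : StrictMono p) {n : ℕ}
    (h : T.Terminal (init p n)) : T.cut p = n := by
  have h1 : init p (n + 1) ∉ T.R := by
    rw [init_succ]
    exact h.2 _ fun a ha => lt_of_mem_init hp ha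
  apply le_antisymm (Nat.sInf_le h1)
  by_contra! hlt
  have h2 : init p (T.cut p + 1) ∉ T.R := Nat.sInf_mem (T.exists_init_notMem hp)
  exact h2 (T.hereditary _ h.1 _ (init_mono p hlt))

theorem top_eq_of_terminal {p : ℕ → ℕ} (hp : StrictMono p) {n : ℕ}
    (h : T.Terminal (init p n)) : T.top p = init p n := by
  rw [top, T.cut_eq_of_terminal hp h]

theorem cut_pos {p : ℕ → ℕ} (hp : StrictMono p) : 0 < T.cut p := by
  by_contra! h
  have := (T.terminal_top hp).nonempty
  rw [top, Nat.le_zero.1 h, init_zero] at this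
  simp at this

theorem init_mem_of_le_cut {p : ℕ → ℕ} (hp : StrictMono p) {n : ℕ} (hn : n ≤ T.cut p) :
    init p n ∈ T.R :=
  T.hereditary _ (T.terminal_top hp).1 _ (init_mono p hn)

/-- This makes `top` locally constant in the sequence, the continuity on which the Ramsey argument
rests. -/
theorem top_congr {p p' : ℕ → ℕ} (hp : StrictMono p) (hp' : StrictMono p')
    (h : ∀ i < T.cut p, p i = p' i) : T.top p' = T.top p := by
  have h1 : init p' (T.cut p) = T.top p := (init_congr h).symm
  rw [T.top_eq_of_terminal hp' (n := T.cut p), h1]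
  rw [h1]
  exact T.terminal_top hp

/-- The pullback of the family along a strictly increasing map. -/
def comap (h : ℕ → ℕ) (hh : StrictMono h) : RankedTree where
  R := {t | t.image h ∈ T.R}
  rk t := T.rk (t.image h)
  singleton_mem n := by simpa using T.singleton_mem (h n)
  hereditary s hs t hts := T.hereditary _ hs _ (Finset.image_subset_image hts)
  extend s n m hn hm hs := by
    simp only [Set.mem_ofPred_eq, Finset.image_insert] at hs ⊢
    refine T.extend _ _ _ ?_ ?_ hs
    · intro a ha
      obtain ⟨b, hb, rfl⟩ := Finset.mem_image.1 ha
      exact hh (hn b hb)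
    · intro a ha
      obtain ⟨b, hb, rfl⟩ := Finset.mem_image.1 ha
      exact hh (hm b hb)
  rk_lt s n hn hs := by
    simp only [Set.mem_ofPred_eq, Finset.image_insert] at hs ⊢
    refine T.rk_lt _ _ ?_ hs
    intro a ha
    obtain ⟨b, hb, rfl⟩ := Finset.mem_image.1 ha
    exact hh (hn b hb)

variable {h : ℕ → ℕ} (hh : StrictMono h)

theorem terminal_comap_iff {t : Finset ℕ} :
    (T.comap h hh).Terminal t ↔ T.Terminal (t.image h) := by
  constructor
  · rintro ⟨h1, h2⟩
    have hlt : ∀ a ∈ t, a < t.sup id + 1 := fun a ha =>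
      Nat.lt_succ_of_le (Finset.le_sup (f := id) ha)
    refine T.terminal_of_insert_notMem h1 (m := h (t.sup id + 1)) ?_ ?_
    · intro a ha
      obtain ⟨b, hb, rfl⟩ := Finset.mem_image.1 ha
      exact hh (hlt b hb)
    · have := h2 _ hlt
      simpa only [comap, Set.mem_ofPred_eq, Finset.image_insert] using this
  · rintro ⟨h1, h2⟩
    refine ⟨h1, fun n hn hins => ?_⟩
    simp only [comap, Set.mem_ofPred_eq, Finset.image_insert] at hins
    refine h2 _ ?_ hins
    intro a ha
    obtain ⟨b, hb, rfl⟩ := Finset.mem_image.1 ha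
    exact hh (hn b hb)

theorem cut_comap (p : ℕ → ℕ) : (T.comap h hh).cut p = T.cut (h ∘ p) := by
  simp only [cut, comap, Set.mem_ofPred_eq, image_init]

theorem image_top_comap (p : ℕ → ℕ) : ((T.comap h hh).top p).image h = T.top (h ∘ p) := by
  rw [top, cut_comap, image_init, top]

open Classical in
/-- The longest initial segment of a finite set that belongs to the family. -/
noncomputable def trunc (t : Finset ℕ) : Finset ℕ := t.filter fun m => t.filter (· ≤ m) ∈ T.R

theorem mem_trunc {t : Finset ℕ} {a : ℕ} :
    a ∈ T.trunc t ↔ a ∈ t ∧ t.filter (· ≤ a) ∈ T.R := by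
  classical
  rw [trunc, Finset.mem_filter]

theorem trunc_subset (t : Finset ℕ) : T.trunc t ⊆ t := fun _ ha => (T.mem_trunc.1 ha).1

theorem trunc_initial {t : Finset ℕ} {a b : ℕ} (ha : a ∈ T.trunc t) (hb : b ∈ t) (hba : b ≤ a) :
    b ∈ T.trunc t := by
  rw [mem_trunc] at ha ⊢
  refine ⟨hb, T.hereditary _ ha.2 _ ?_⟩
  exact Finset.monotone_filter_right _ fun c _ hc => le_trans hc hba

theorem trunc_mem (t : Finset ℕ) : T.trunc t ∈ T.R := by
  rcases (T.trunc t).eq_empty_or_nonempty with h | h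
  · rw [h]
    exact T.empty_mem
  · have := Finset.max'_mem _ h
    rw [mem_trunc] at this
    refine T.hereditary _ this.2 _ fun a ha => ?_
    exact Finset.mem_filter.2 ⟨T.trunc_subset t ha, Finset.le_max' _ _ ha⟩

theorem trunc_nonempty {t : Finset ℕ} (ht : t.Nonempty) : (T.trunc t).Nonempty := by
  refine ⟨t.min' ht, T.mem_trunc.2 ⟨Finset.min'_mem _ _, ?_⟩⟩
  refine T.hereditary _ (T.singleton_mem (t.min' ht)) _ fun a ha => ?_
  rw [Finset.mem_filter] at ha
  exact Finset.mem_singleton.2 (le_antisymm ha.2 (Finset.min'_le _ _ ha.1))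

theorem trunc_congr {t t' : Finset ℕ} {n : ℕ} (h : ∀ m < n, m ∈ t' ↔ m ∈ t) :
    ∀ m < n, m ∈ T.trunc t' ↔ m ∈ T.trunc t := by
  intro m hm
  have : t'.filter (· ≤ m) = t.filter (· ≤ m) := by
    ext a
    simp only [Finset.mem_filter]
    constructor
    · rintro ⟨h1, h2⟩
      exact ⟨(h a (by omega)).1 h1, h2⟩
    · rintro ⟨h1, h2⟩
      exact ⟨(h a (by omega)).2 h1, h2⟩
  rw [mem_trunc, mem_trunc, this, h m hm]

/-- If the truncation is proper, the first omitted point is an extension outside the tree, and one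
failing later point excludes all of them. -/
theorem terminal_trunc {t : Finset ℕ} (ht : t ∈ T.R → T.Terminal t) : T.Terminal (T.trunc t) := by
  by_cases heq : T.trunc t = t
  · have := T.trunc_mem t
    rw [heq] at this ⊢
    exact ht this
  · have hne : (t \ T.trunc t).Nonempty := by
      rw [Finset.sdiff_nonempty]
      exact fun h => heq (Finset.Subset.antisymm (T.trunc_subset t) h)
    set m := (t \ T.trunc t).min' hne with hm
    have hmem : m ∈ t \ T.trunc t := Finset.min'_mem _ _
    rw [Finset.mem_sdiff] at hmem
    have hlt : ∀ a ∈ T.trunc t, a < m := by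
      intro a ha
      by_contra! hma
      exact hmem.2 (T.trunc_initial ha hmem.1 hma)
    have hfil : t.filter (· ≤ m) = insert m (T.trunc t) := by
      ext a
      rw [Finset.mem_filter, Finset.mem_insert]
      constructor
      · rintro ⟨h1, h2⟩
        by_contra! h3
        have : m ≤ a := Finset.min'_le _ _ (Finset.mem_sdiff.2 ⟨h1, h3.2⟩)
        exact h3.1 (le_antisymm h2 this)
      · rintro (rfl | h)
        · exact ⟨hmem.1, le_rfl⟩
        · exact ⟨T.trunc_subset t h, (hlt a h).le⟩
    refine T.terminal_of_insert_notMem (T.trunc_mem t) hlt fun hins => hmem.2 ?_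
    rw [mem_trunc, hfil]
    exact ⟨hmem.1, hins⟩

theorem elt_trunc {t : Finset ℕ} {k : ℕ} (hk : k < (T.trunc t).card) :
    elt (T.trunc t : Set ℕ) k = elt (t : Set ℕ) k :=
  (elt_eq_elt_of_initial (T.trunc_subset t)
    (fun _ ha _ hb hba => T.trunc_initial ha hb hba) hk).symm

end RankedTree

/-! ### Weakly continuous maps on trees -/

/-- A weakly continuous map from a ranked tree into a Banach space. -/
structure WeakSystem (X : Type*) [NormedAddCommGroup X] [NormedSpace ℝ X] extends RankedTree where
  /-- the map -/
  φ : Finset ℕ → X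
  cont : ∀ s ∈ R, ∀ f : X →L[ℝ] ℝ, ∀ ε > 0, ∃ n, ∀ t ∈ R, (∀ m < n, m ∈ t ↔ m ∈ s) →
    |f (φ t) - f (φ s)| < ε

namespace WeakSystem

variable {X : Type*} [NormedAddCommGroup X] [NormedSpace ℝ X] (W : WeakSystem X)

/-- The pullback of a weakly continuous map along a strictly increasing map. -/
def comap (h : ℕ → ℕ) (hh : StrictMono h) : WeakSystem X where
  __ := W.toRankedTree.comap h hh
  φ t := W.φ (t.image h)
  cont s hs f ε hε := by
    obtain ⟨n, hn⟩ := W.cont _ hs f ε hε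
    refine ⟨n, fun t ht hts => hn _ ht fun m hm => ?_⟩
    simp only [Finset.mem_image]
    constructor
    · rintro ⟨a, ha, rfl⟩
      exact ⟨a, (hts a (hh.le_apply.trans_lt hm)).1 ha, rfl⟩
    · rintro ⟨a, ha, rfl⟩
      exact ⟨a, (hts a (hh.le_apply.trans_lt hm)).2 ha, rfl⟩

theorem φ_top_comap {h : ℕ → ℕ} (hh : StrictMono h) (p : ℕ → ℕ) :
    (W.comap h hh).φ ((W.comap h hh).top p) = W.φ (W.top (h ∘ p)) :=
  congrArg W.φ (W.toRankedTree.image_top_comap hh p)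

theorem tendsto_insert {s : Finset ℕ} {n : ℕ} (hn : ∀ a ∈ s, a < n) (hs : insert n s ∈ W.R)
    (f : X →L[ℝ] ℝ) : Tendsto (fun m => f (W.φ (insert m s))) atTop (𝓝 (f (W.φ s))) := by
  rw [Metric.tendsto_atTop]
  intro ε hε
  obtain ⟨N, hN⟩ := W.cont s (W.hereditary _ hs _ (Finset.subset_insert _ _)) f ε hε
  refine ⟨max N (s.sup id + 1), fun m hm => ?_⟩
  rw [Real.dist_eq]
  refine hN _ (W.extend s n m hn ?_ hs) fun a ha => ?_
  · intro a ha
    have := Finset.le_sup (f := id) ha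
    simp only [id] at this
    omega
  · rw [Finset.mem_insert]
    constructor
    · rintro (rfl | h)
      · omega
      · exact h
    · exact Or.inr

/-- The value at a nonterminal node is a limit of values at its one-point extensions, which have
smaller rank. -/
theorem abs_apply_le_of_terminal {C : ℝ} {f : X →L[ℝ] ℝ}
    (h : ∀ t, W.Terminal t → |f (W.φ t)| ≤ C) {t : Finset ℕ} (ht : t ∈ W.R) :
    |f (W.φ t)| ≤ C := by
  induction hr : W.rk t using WellFoundedLT.induction generalizing t with
  | _ o ih =>
  by_cases hterm : W.Terminal t
  · exact h t hterm
  · have : ∃ n, (∀ a ∈ t, a < n) ∧ insert n t ∈ W.R := by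
      by_contra! h'
      exact hterm ⟨ht, h'⟩
    obtain ⟨n, hn, hins⟩ := this
    have hev : ∀ᶠ m in atTop, |f (W.φ (insert m t))| ≤ C := by
      filter_upwards [eventually_ge_atTop n] with m hm
      have hm' : ∀ a ∈ t, a < m := fun a ha => (hn a ha).trans_le hm
      have hmem := W.extend t n m hn hm' hins
      exact ih _ (hr ▸ W.rk_lt t m hm' hmem) hmem rfl
    exact le_of_tendsto (W.tendsto_insert hn hins f).abs hev

theorem norm_le_of_terminal {C : ℝ} (hC : 0 ≤ C) (h : ∀ t, W.Terminal t → ‖W.φ t‖ ≤ C)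
    {t : Finset ℕ} (ht : t ∈ W.R) : ‖W.φ t‖ ≤ C := by
  apply NormedSpace.norm_le_dual_bound ℝ _ hC
  intro f
  refine W.abs_apply_le_of_terminal (f := f) (fun t ht => ?_) ht
  calc |f (W.φ t)| ≤ ‖f‖ * ‖W.φ t‖ := f.le_opNorm _
    _ ≤ ‖f‖ * C := by gcongr; exact h t ht
    _ = C * ‖f‖ := mul_comm _ _

/-- Terminal nodes far out converge to `∅`; there weak continuity and weak nullness force the same
limit. -/
theorem φ_empty_eq_zero (h : ∀ f : X →L[ℝ] ℝ, ∀ ε > 0, ∃ n₀ : ℕ, ∀ t, W.Terminal t →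
    (∀ m ∈ t, n₀ ≤ m) → |f (W.φ t)| < ε) : W.φ ∅ = 0 := by
  apply SeparatingDual.eq_zero_of_forall_dual_eq_zero (R := ℝ)
  intro f
  by_contra hne
  have hpos : 0 < |f (W.φ ∅)| / 2 := half_pos (abs_pos.2 hne)
  obtain ⟨n₁, h1⟩ := W.cont ∅ W.empty_mem f _ hpos
  obtain ⟨n₂, h2⟩ := h f _ hpos
  have hp : StrictMono (fun i => max n₁ n₂ + i) := fun a b hab => by simpa using hab
  have ht := W.terminal_top hp
  have hge : ∀ m ∈ W.top (fun i => max n₁ n₂ + i), max n₁ n₂ ≤ m := by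
    intro m hm
    obtain ⟨i, -, rfl⟩ := mem_init.1 hm
    exact Nat.le_add_right _ _
  have h3 := h1 _ ht.1 fun m hm => by
    constructor
    · intro hm'
      have := hge m hm'
      omega
    · simp
  have h4 := h2 _ ht fun m hm => (le_max_right _ _).trans (hge m hm)
  have h5 := abs_sub_abs_le_abs_sub (f (W.φ ∅)) (f (W.φ (W.top fun i => max n₁ n₂ + i)))
  rw [abs_sub_comm] at h5
  linarith

end WeakSystem


/-! ### A Ramsey theorem for continuous functions of infinite sequences -/

theorem exists_strictMono_init_eq (s : Finset ℕ) :
    ∃ p : ℕ → ℕ, StrictMono p ∧ init p s.card = s := by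
  refine ⟨fun i => if i < s.card then elt (s : Set ℕ) i else s.sup id + 1 + i, ?_,
    init_eq_of_elt fun i hi => by simp [hi]⟩
  apply strictMono_nat_of_lt_succ
  intro i
  by_cases h1 : i + 1 < s.card
  · simp only [h1, (Nat.lt_succ_self i).trans h1, if_true]
    exact elt_lt_elt (Nat.lt_succ_self i) h1
  · by_cases h2 : i < s.card
    · simp only [h1, h2, if_true, if_false]
      have := Finset.le_sup (f := id) (elt_mem h2)
      simp only [id] at this ⊢
      omega
    · simp only [h1, h2, if_false]
      omega

theorem init_insert_eq {s : Finset ℕ} {n : ℕ} (hn : ∀ a ∈ s, a < n) {p : ℕ → ℕ}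
    (hp : StrictMono p) (h : init p (insert n s).card = insert n s) : init p s.card = s := by
  have hns : n ∉ s := fun h => (hn n h).false
  have hc := Finset.card_insert_of_notMem hns
  rw [hc, init_succ] at h
  have hmax : p s.card = n := by
    have h1 : p s.card ∈ insert n s := h ▸ Finset.mem_insert_self _ _
    have h2 : n ∈ insert (p s.card) (init p s.card) := h ▸ Finset.mem_insert_self _ _
    rcases Finset.mem_insert.1 h1 with h1 | h1
    · exact h1
    · rcases Finset.mem_insert.1 h2 with h2 | h2
      · exact h2.symm
      · have := hn _ h1
        have := lt_of_mem_init hp h2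
        omega
  have h3 : p s.card ∉ init p s.card := fun h => (lt_of_mem_init hp h).false
  rw [hmax] at h h3
  have := congrArg (fun t => t.erase n) h
  simpa [Finset.erase_insert h3, Finset.erase_insert hns] using this

/-- A function of increasing sequences is constant on the extensions of `s`. -/
def ConstAbove (c : (ℕ → ℕ) → ℝ) (s : Finset ℕ) : Prop :=
  ∀ p p' : ℕ → ℕ, StrictMono p → StrictMono p' → init p s.card = s → init p' s.card = s →
    c p = c p'

/-- An infinite chain of extensions enumerates an increasing sequence. The function is constant near
it, hence constant above some node of the chain. -/
theorem wellFounded_not_constAbove {c : (ℕ → ℕ) → ℝ}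
    (hloc : ∀ p, StrictMono p → ∃ n, ∀ p', StrictMono p' → (∀ j < n, p j = p' j) → c p' = c p) :
    WellFounded (fun t s : Finset ℕ =>
      ¬ ConstAbove c s ∧ ∃ n, (∀ a ∈ s, a < n) ∧ t = insert n s) := by
  rw [wellFounded_iff_isEmpty_descending_chain]
  refine ⟨fun ⟨f, hf⟩ => ?_⟩
  have hf1 := fun n => (hf n).1
  choose p hp1 hp2 using fun n => (hf n).2
  set k := (f 0).card with hk
  let q : ℕ → ℕ := fun i => if i < k then elt (f 0 : Set ℕ) i else p (i - k)
  have hqk : ∀ n, q (k + n) = p n := fun n => by simp [q]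
  have hinit : ∀ n, init q (k + n) = f n := by
    intro n
    induction n with
    | zero =>
      rw [Nat.add_zero, hk]
      exact init_eq_of_elt fun i hi => by simp [q, hk, hi]
    | succ n ih => rw [← Nat.add_assoc, init_succ, ih, hqk, hp2]
  have hq : StrictMono q := by
    apply strictMono_nat_of_lt_succ
    intro i
    rcases lt_or_ge (i + 1) k with h1 | h1
    · simp only [q, h1, (Nat.lt_succ_self i).trans h1, if_true]
      exact elt_lt_elt (Nat.lt_succ_self i) h1
    · obtain ⟨n, hn⟩ := Nat.exists_eq_add_of_le h1
      have h2 : q i ∈ f n := by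
        rw [← hinit n, mem_init]
        exact ⟨i, by omega, rfl⟩
      rw [hn, hqk]
      exact hp1 n _ h2
  obtain ⟨n, hn⟩ := hloc q hq
  have hcard : (f n).card = k + n := by rw [← hinit n, card_init hq]
  have key : ∀ r : ℕ → ℕ, StrictMono r → init r (f n).card = f n → c r = c q := by
    intro r hr hr'
    refine hn r hr fun j hj => ?_
    have hj' : j < k + n := by omega
    rw [hcard, ← hinit n] at hr'
    rw [← elt_init hq hj', ← elt_init hr hj', hr']
  exact hf1 n fun r r' hr hr' h1 h2 => (key r hr h1).trans (key r' hr' h2).symm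

theorem exists_tendsto_hyperfilter {g : ℕ → ℝ} {C : ℝ} (hg : ∀ n, |g n| ≤ C) :
    ∃ x, |x| ≤ C ∧ Tendsto g (hyperfilter ℕ : Filter ℕ) (𝓝 x) := by
  have hK : IsCompact (Set.Icc (-C) C) := isCompact_Icc
  obtain ⟨x, hx, hle⟩ := hK.ultrafilter_le_nhds ((hyperfilter ℕ).map g) (by
    rw [le_principal_iff, Ultrafilter.mem_coe, Ultrafilter.mem_map]
    exact Filter.Eventually.of_forall (f := (hyperfilter ℕ : Filter ℕ)) fun n => abs_le.1 (hg n))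
  exact ⟨x, abs_le.2 hx, hle⟩

/-- A continuous function of increasing sequences extends to finite sets, in such a way that its
value at a finite set is the ultrafilter limit of the values at its one-point extensions. -/
theorem exists_extension_tendsto {c : (ℕ → ℕ) → ℝ} {C : ℝ} (hC : ∀ p, |c p| ≤ C)
    (hloc : ∀ p, StrictMono p → ∃ n, ∀ p', StrictMono p' → (∀ j < n, p j = p' j) → c p' = c p) :
    ∃ v : Finset ℕ → ℝ,
      (∀ s, Tendsto (fun n => v (insert n s)) (hyperfilter ℕ : Filter ℕ) (𝓝 (v s))) ∧
      ∀ p, StrictMono p → ∃ n, v (init p n) = c p := by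
  classical
  have wf := wellFounded_not_constAbove hloc
  choose ext hext1 hext2 using exists_strictMono_init_eq
  -- Where the function is already constant, that constant is taken; otherwise the ultrafilter limit
  -- over later points. The default 0 occurs for finitely many `n` only, which the ultrafilter
  -- ignores.
  let F : ∀ s : Finset ℕ, (∀ t, (¬ ConstAbove c s ∧ ∃ n, (∀ a ∈ s, a < n) ∧ t = insert n s) → ℝ)
      → ℝ := fun s IH =>
    if h : ConstAbove c s then c (ext s) else
      limUnder (hyperfilter ℕ : Filter ℕ)
        (fun n => if hn : ∀ a ∈ s, a < n then IH (insert n s) ⟨h, n, hn, rfl⟩ else 0)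
  let v : Finset ℕ → ℝ := wf.fix F
  have hv1 : ∀ s, ConstAbove c s → v s = c (ext s) := fun s hs => by
    simp only [v]
    rw [wf.fix_eq]
    simp only [F, hs, dif_pos]
  have hv2 : ∀ s, ¬ ConstAbove c s → v s = limUnder (hyperfilter ℕ : Filter ℕ)
      (fun n => if ∀ a ∈ s, a < n then v (insert n s) else 0) := fun s hs => by
    simp only [v]
    rw [wf.fix_eq]
    simp only [F, hs, dif_neg, not_false_eq_true]
    congr 1
  have hC0 : 0 ≤ C := (abs_nonneg _).trans (hC id)
  have hbt : ∀ s, |v s| ≤ C := by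
    intro s
    induction s using wf.induction with
    | _ s ih =>
    by_cases hs : ConstAbove c s
    · rw [hv1 s hs]
      exact hC _
    · obtain ⟨x, hx, hlim⟩ := exists_tendsto_hyperfilter
        (g := fun n => if ∀ a ∈ s, a < n then v (insert n s) else 0) (C := C) (fun n => by
          split_ifs with hn
          · exact ih _ ⟨hs, n, hn, rfl⟩
          · simpa using hC0)
      rw [hv2 s hs, hlim.limUnder_eq]
      exact hx
  have hgt : ∀ s : Finset ℕ, ∀ᶠ n in (hyperfilter ℕ : Filter ℕ), ∀ a ∈ s, a < n := by
    intro s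
    refine Filter.Eventually.filter_mono Nat.hyperfilter_le_atTop ?_
    filter_upwards [eventually_gt_atTop (s.sup id)] with n hn a ha
    exact (Finset.le_sup (f := id) ha).trans_lt hn
  refine ⟨v, fun s => ?_, fun p hp => ?_⟩
  · by_cases hs : ConstAbove c s
    · apply tendsto_nhds_of_eventually_eq
      filter_upwards [hgt s] with n hn
      have hins : ConstAbove c (insert n s) := fun p p' hp hp' h h' =>
        hs p p' hp hp' (init_insert_eq hn hp h) (init_insert_eq hn hp' h')
      rw [hv1 _ hins, hv1 _ hs]
      exact hs _ _ (hext1 _) (hext1 _) (init_insert_eq hn (hext1 _) (hext2 _)) (hext2 _)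
    · obtain ⟨x, hx, hlim⟩ := exists_tendsto_hyperfilter
        (g := fun n => if ∀ a ∈ s, a < n then v (insert n s) else 0) (C := C) (fun n => by
          split_ifs with hn
          · exact hbt _
          · simpa using hC0)
      rw [hv2 s hs, hlim.limUnder_eq]
      refine hlim.congr' ?_
      filter_upwards [hgt s] with n hn
      rw [if_pos hn]
  · obtain ⟨n, hn⟩ := hloc p hp
    refine ⟨n, ?_⟩
    have key : ∀ r : ℕ → ℕ, StrictMono r → init r (init p n).card = init p n → c r = c p := by
      intro r hr hr'
      refine hn r hr fun j hj => ?_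
      rw [card_init hp] at hr'
      rw [← elt_init hp hj, ← elt_init hr hj, hr']
    have : ConstAbove c (init p n) := fun r r' hr hr' h1 h2 =>
      (key r hr h1).trans (key r' hr' h2).symm
    rw [hv1 _ this]
    exact key _ (hext1 _) (hext2 _)

/-- **Ramsey theorem**: countably many bounded continuous functions of increasing sequences can be
made asymptotically constant by passing to a subsequence. -/
theorem exists_strictMono_asymptotically_const {c : ℕ → (ℕ → ℕ) → ℝ}
    (hC : ∀ i, ∃ C, ∀ p, |c i p| ≤ C)
    (hloc : ∀ i p, StrictMono p →
      ∃ n, ∀ p', StrictMono p' → (∀ j < n, p j = p' j) → c i p' = c i p) :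
    ∃ M : ℕ → ℕ, StrictMono M ∧ ∃ ρ : ℕ → ℝ, ∀ i, ∀ ε > 0, ∃ n₀, ∀ θ : ℕ → ℕ, StrictMono θ →
      n₀ ≤ θ 0 → |c i (M ∘ θ) - ρ i| ≤ ε := by
  choose C hC using hC
  choose v hv1 hv2 using fun i => exists_extension_tendsto (hC i) (hloc i)
  -- The term `M j` is chosen so that adjoining it to any set of earlier terms moves each of the
  -- first `j + 1` extended functions by at most `2^{-j}`. Along a sequence these changes telescope
  -- from the value at `∅`.
  obtain ⟨M, hM, hQ⟩ := exists_strictMono_diagonal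
    (fun j M m => ∀ i ∈ Finset.range (j + 1), ∀ t ∈ (Finset.range j).powerset,
      |v i (insert m (t.image M)) - v i (t.image M)| ≤ (1 / 2 : ℝ) ^ j)
    (fun j M M' m h hQ i hi t ht => by
      have : t.image M' = t.image M := Finset.image_congr fun a ha =>
        (h a (Finset.mem_range.1 (Finset.mem_powerset.1 ht ha))).symm
      rw [this]
      exact hQ i hi t ht)
    (fun j M => by
      have hev : ∀ᶠ m in (hyperfilter ℕ : Filter ℕ), ∀ i ∈ Finset.range (j + 1),
          ∀ t ∈ (Finset.range j).powerset,
          |v i (insert m (t.image M)) - v i (t.image M)| ≤ (1 / 2 : ℝ) ^ j := by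
        rw [Finset.eventually_all]
        intro i _
        rw [Finset.eventually_all]
        intro t _
        have := (Metric.tendsto_nhds.1 (hv1 i (t.image M))) ((1 / 2 : ℝ) ^ j) (by positivity)
        filter_upwards [this] with m hm
        rw [Real.dist_eq] at hm
        exact hm.le
      exact hev.frequently.filter_mono Nat.hyperfilter_le_atTop)
  refine ⟨M, hM, fun i => v i ∅, fun i ε hε => ?_⟩
  obtain ⟨n₁, hn₁⟩ := exists_pow_lt_of_lt_one (half_pos hε) (by norm_num : (1 / 2 : ℝ) < 1)
  refine ⟨max i n₁, fun θ hθ h0 => ?_⟩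
  have hstep : ∀ n, |v i (init (M ∘ θ) (n + 1)) - v i (init (M ∘ θ) n)| ≤
      (1 / 2 : ℝ) ^ (θ 0 + n) := by
    intro n
    have hle : θ 0 + n ≤ θ n := by
      induction n with
      | zero => exact le_rfl
      | succ n ih => have : θ n < θ (n + 1) := hθ (Nat.lt_succ_self n); omega
    have := hQ (θ n) i (Finset.mem_range.2 (by omega)) (init θ n) (by
      rw [Finset.mem_powerset]
      intro a ha
      exact Finset.mem_range.2 (lt_of_mem_init hθ ha))
    rw [image_init] at this
    rw [init_succ]
    exact this.trans (pow_le_pow_of_le_one (by norm_num) (by norm_num) hle)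
  -- The factor `1 - (1/2)^n` is the exact partial geometric sum, which makes the induction close.
  have hsum : ∀ n, |v i (init (M ∘ θ) n) - v i ∅| ≤
      2 * (1 / 2 : ℝ) ^ θ 0 * (1 - (1 / 2 : ℝ) ^ n) := by
    intro n
    induction n with
    | zero => simp
    | succ n ih =>
      have h1 := abs_sub_le (v i (init (M ∘ θ) (n + 1))) (v i (init (M ∘ θ) n)) (v i ∅)
      have h2 := hstep n
      rw [pow_add] at h2
      rw [pow_succ]
      nlinarith
  obtain ⟨n, hn⟩ := hv2 i (M ∘ θ) (hM.comp hθ)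
  rw [← hn]
  refine (hsum n).trans ?_
  have h1 : (1 / 2 : ℝ) ^ θ 0 ≤ (1 / 2 : ℝ) ^ n₁ :=
    pow_le_pow_of_le_one (by norm_num) (by norm_num) (by omega)
  have h2 : (0 : ℝ) ≤ (1 / 2 : ℝ) ^ n := by positivity
  have h3 : (0 : ℝ) ≤ (1 / 2 : ℝ) ^ θ 0 := by positivity
  nlinarith


/-! ### Arrays of weakly continuous maps -/

/-- The subsequence of `p` along the residue class of `i` modulo `r`. -/
def strand (r i : ℕ) (p : ℕ → ℕ) : ℕ → ℕ := fun q => p (q * r + i)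

theorem strictMono_strand {r : ℕ} (hr : 0 < r) (i : ℕ) {p : ℕ → ℕ} (hp : StrictMono p) :
    StrictMono (strand r i p) := fun _ _ hab =>
  hp (Nat.add_lt_add_right (Nat.mul_lt_mul_of_pos_right hab hr) _)

variable {X : Type*} [NormedAddCommGroup X] [NormedSpace ℝ X]

/-- The linear combination of the values of the systems `W (κ i)` along the strands of `p`. -/
noncomputable def arraySum (W : ℕ → WeakSystem X) {r : ℕ} (κ : Fin r → ℕ) (A : Fin r → ℝ)
    (p : ℕ → ℕ) : X :=
  ∑ i, A i • (W (κ i)).φ ((W (κ i)).top (strand r i p))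

/-- The norms of the linear combinations along strands are asymptotically constant. -/
def Stable (W : ℕ → WeakSystem X) : Prop :=
  ∀ (r : ℕ) (κ : Fin r → ℕ) (A : Fin r → ℝ), ∀ ε > 0, ∃ n₀, ∀ p p' : ℕ → ℕ, StrictMono p →
    StrictMono p' → n₀ ≤ p 0 → n₀ ≤ p' 0 → |‖arraySum W κ A p‖ - ‖arraySum W κ A p'‖| ≤ ε

theorem norm_arraySum_sub_le {W : ℕ → WeakSystem X} {C : ℝ}
    (hC : ∀ k, ∀ t ∈ (W k).R, ‖(W k).φ t‖ ≤ C) {r : ℕ} (κ : Fin r → ℕ) (A B : Fin r → ℝ)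
    {p : ℕ → ℕ} (hp : StrictMono p) :
    ‖arraySum W κ A p - arraySum W κ B p‖ ≤ (∑ i, |A i - B i|) * C := by
  rw [arraySum, arraySum, ← Finset.sum_sub_distrib, Finset.sum_mul]
  refine (norm_sum_le _ _).trans (Finset.sum_le_sum fun i _ => ?_)
  rw [← sub_smul, norm_smul, Real.norm_eq_abs]
  have hr : 0 < r := i.pos
  gcongr
  exact hC _ _ ((W (κ i)).terminal_top (strictMono_strand hr i hp)).1

theorem norm_arraySum_le {W : ℕ → WeakSystem X} {C : ℝ}
    (hC : ∀ k, ∀ t ∈ (W k).R, ‖(W k).φ t‖ ≤ C) {r : ℕ} (κ : Fin r → ℕ) (A : Fin r → ℝ)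
    {p : ℕ → ℕ} (hp : StrictMono p) : ‖arraySum W κ A p‖ ≤ (∑ i, |A i|) * C := by
  have := norm_arraySum_sub_le hC κ A 0 hp
  simpa [arraySum] using this

theorem arraySum_congr (W : ℕ → WeakSystem X) {r : ℕ} (κ : Fin r → ℕ) {p : ℕ → ℕ}
    (hp : StrictMono p) : ∃ n, ∀ p', StrictMono p' → (∀ j < n, p j = p' j) →
      ∀ A : Fin r → ℝ, arraySum W κ A p' = arraySum W κ A p := by
  -- Each strand is read up to its cut, and term `q` of strand `i` sits at position `q * r + i`.
  refine ⟨(∑ i, (W (κ i)).cut (strand r i p)) * r, fun p' hp' h A => ?_⟩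
  refine Finset.sum_congr rfl fun i _ => ?_
  have hr : 0 < r := i.pos
  rw [(W (κ i)).top_congr (strictMono_strand hr i hp) (strictMono_strand hr i hp')]
  intro q hq
  apply h
  have h1 : (W (κ i)).cut (strand r i p) ≤ ∑ i, (W (κ i)).cut (strand r i p) :=
    Finset.single_le_sum (f := fun i => (W (κ i)).cut (strand r i p))
      (fun _ _ => Nat.zero_le _) (Finset.mem_univ i)
  have h2 : (q + 1) * r ≤ (∑ i, (W (κ i)).cut (strand r i p)) * r :=
    Nat.mul_le_mul_right r (hq.trans_le h1)
  have h3 := i.2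
  rw [add_mul] at h2
  omega

theorem arraySum_comap (W : ℕ → WeakSystem X) {M : ℕ → ℕ} (hM : StrictMono M) {r : ℕ}
    (κ : Fin r → ℕ) (A : Fin r → ℝ) (p : ℕ → ℕ) :
    arraySum (fun k => (W k).comap M hM) κ A p = arraySum W κ A (M ∘ p) :=
  Finset.sum_congr rfl fun i _ =>
    congrArg (A i • ·) ((W (κ i)).φ_top_comap hM (strand r i p))

/-- Rational coefficients leave countably many norm functions for the Ramsey theorem; real ones
follow because the vectors are uniformly bounded. -/
theorem exists_stable {W : ℕ → WeakSystem X} {C : ℝ}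
    (hC : ∀ k, ∀ t ∈ (W k).R, ‖(W k).φ t‖ ≤ C) :
    ∃ (M : ℕ → ℕ) (hM : StrictMono M), Stable fun k => (W k).comap M hM := by
  classical
  have hC0 : 0 ≤ C := (norm_nonneg _).trans (hC 0 ∅ (W 0).empty_mem)
  obtain ⟨enum, henum⟩ := exists_surjective_nat (Σ r : ℕ, (Fin r → ℕ) × (Fin r → ℚ))
  -- The value 0 off the increasing sequences serves to make the functions bounded everywhere.
  let c : ℕ → (ℕ → ℕ) → ℝ := fun i p =>
    if StrictMono p then ‖arraySum W (enum i).2.1 (fun j => ((enum i).2.2 j : ℝ)) p‖ else 0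
  have hcC : ∀ i, ∃ C, ∀ p, |c i p| ≤ C := by
    intro i
    refine ⟨(∑ j, |((enum i).2.2 j : ℝ)|) * C, fun p => ?_⟩
    by_cases hp : StrictMono p
    · simp only [c, hp, if_true, abs_norm]
      exact norm_arraySum_le hC _ _ hp
    · simp only [c, hp, if_false, abs_zero]
      exact mul_nonneg (Finset.sum_nonneg fun _ _ => abs_nonneg _) hC0
  have hloc : ∀ i p, StrictMono p →
      ∃ n, ∀ p', StrictMono p' → (∀ j < n, p j = p' j) → c i p' = c i p := by
    intro i p hp
    obtain ⟨n, hn⟩ := arraySum_congr W (enum i).2.1 hp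
    refine ⟨n, fun p' hp' h => ?_⟩
    simp only [c, hp, hp', if_true, hn p' hp' h]
  obtain ⟨M, hM, ρ, hρ⟩ := exists_strictMono_asymptotically_const hcC hloc
  refine ⟨M, hM, fun r κ A ε hε => ?_⟩
  have hη : 0 < ε / (4 * ((r + 1) * (C + 1))) := by positivity
  choose B hB using fun i => exists_rat_near (A i) hη
  obtain ⟨i, hi⟩ := henum ⟨r, κ, B⟩
  obtain ⟨n₀, hn₀⟩ := hρ i (ε / 4) (by positivity)
  have hclose : ∀ p, StrictMono p → |‖arraySum W κ A p‖ -
      ‖arraySum W κ (fun j => (B j : ℝ)) p‖| ≤ ε / 4 := by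
    intro p hp
    refine (abs_norm_sub_norm_le _ _).trans ((norm_arraySum_sub_le hC κ A _ hp).trans ?_)
    have h1 : ∑ j, |A j - B j| ≤ r * (ε / (4 * ((r + 1) * (C + 1)))) := by
      have := Finset.sum_le_sum fun j (_ : j ∈ Finset.univ) => (hB j).le
      simpa using this
    calc (∑ j, |A j - B j|) * C ≤ r * (ε / (4 * ((r + 1) * (C + 1)))) * C := by gcongr
      _ ≤ (r + 1) * (ε / (4 * ((r + 1) * (C + 1)))) * (C + 1) := by
          gcongr <;> linarith
      _ = ε / 4 := by field_simp
  refine ⟨n₀, fun p p' hp hp' h h' => ?_⟩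
  rw [arraySum_comap, arraySum_comap]
  have e1 := hn₀ p hp h
  have e2 := hn₀ p' hp' h'
  have e3 := hclose _ (hM.comp hp)
  have e4 := hclose _ (hM.comp hp')
  have hci : ∀ x, enum i = x → ∀ p, StrictMono p →
      c i p = ‖arraySum W x.2.1 (fun j => (x.2.2 j : ℝ)) p‖ := by
    rintro _ rfl p hp
    simp only [c, hp, if_true]
  rw [hci _ hi _ (hM.comp hp)] at e1
  rw [hci _ hi _ (hM.comp hp')] at e2
  rw [abs_le] at *
  constructor <;> linarith [e1.1, e1.2, e2.1, e2.2, e3.1, e3.2, e4.1, e4.2]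

/-! ### Suppression of terms -/

/-- For one functional the point exists by weak convergence. The functionals served by points up to
`N'` form an increasing weak-star open cover of the dual ball, so compactness gives one bound for
all of them. -/
theorem WeakSystem.eventually_exists_abs_sub_le (W : WeakSystem X) {s : Finset ℕ} {n : ℕ}
    (hn : ∀ a ∈ s, a < n) (hs : insert n s ∈ W.R) {ε : ℝ} (hε : 0 < ε) (N : ℕ) :
    ∀ᶠ N' in atTop, ∀ f : X →L[ℝ] ℝ, ‖f‖ ≤ 1 →
      ∃ m, N < m ∧ m ≤ N' ∧ |f (W.φ (insert m s)) - f (W.φ s)| ≤ ε := by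
  let U : ℕ → Set (WeakDual ℝ X) := fun N' =>
    ⋃ m ∈ Finset.Ioc N N', {f | |f (W.φ (insert m s) - W.φ s)| < ε}
  have hU : ∀ N', IsOpen (U N') := fun N' =>
    isOpen_biUnion fun m _ => isOpen_lt (WeakDual.eval_continuous _).abs continuous_const
  have hmono : Monotone U := fun _ _ hab =>
    Set.biUnion_subset_biUnion_left fun m hm =>
      Finset.Ioc_subset_Ioc_right hab hm
  obtain ⟨N', hN'⟩ := (WeakDual.isCompact_closedBall (𝕜 := ℝ) (E := X) 0 1).elim_directed_cover
    U hU (fun f _ => by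
      have hf := W.tendsto_insert hn hs (WeakDual.toStrongDual f)
      obtain ⟨m, hm1, hm2⟩ := ((Metric.tendsto_nhds.1 hf ε hε).and
        (eventually_gt_atTop N)).exists
      refine Set.mem_iUnion.2 ⟨m, Set.mem_biUnion (x := m) (by simp [hm2]) ?_⟩
      rw [Real.dist_eq, ← map_sub] at hm1
      exact hm1) hmono.directed_le
  filter_upwards [eventually_ge_atTop N'] with N'' hN'' f hf
  have : StrongDual.toWeakDual f ∈ U N' := hN' (by
    simpa using hf)
  obtain ⟨m, hm, hlt⟩ := Set.mem_iUnion₂.1 this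
  rw [Finset.mem_Ioc] at hm
  refine ⟨m, hm.1, hm.2.trans hN'', ?_⟩
  rw [← map_sub]
  exact (show |f (W.φ (insert m s) - W.φ s)| < ε from hlt).le

theorem exists_seq_init (Q : ℕ → Finset ℕ → ℕ → Prop) (h : ∀ j B, ∃ m, Q j B m) :
    ∃ q : ℕ → ℕ, ∀ j, Q j (init q j) (q j) := by
  choose F hF using h
  let G : ℕ → Finset ℕ := fun n => Nat.rec ∅ (fun j B => insert (F j B) B) n
  have hG : ∀ j, init (fun j => F j (G j)) j = G j := by
    intro j
    induction j with
    | zero => simp [G]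
    | succ j ih => rw [init_succ, ih]
  refine ⟨fun j => F j (G j), fun j => ?_⟩
  rw [hG]
  exact hF _ _

/-- The block boundaries do not depend on the functional, so branches built for different
functionals can later be interlaced. The errors are summable over the blocks. -/
theorem exists_blocks (W : ℕ → WeakSystem X) {r : ℕ} (κ : Fin r → ℕ) {η : ℝ} (hη : 0 < η)
    (n₀ : ℕ) : ∃ b : ℕ → ℕ, StrictMono b ∧ n₀ ≤ b 0 ∧ ∀ n (i : Fin r) (B : Finset ℕ),
      B ⊆ Finset.range (b n + 1) → (∃ x, (∀ a ∈ B, a < x) ∧ insert x B ∈ (W (κ i)).R) →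
      ∀ f : X →L[ℝ] ℝ, ‖f‖ ≤ 1 → ∃ m, b n < m ∧ m ≤ b (n + 1) ∧
        |f ((W (κ i)).φ (insert m B)) - f ((W (κ i)).φ B)| ≤ η * (1 / 2) ^ n := by
  have key : ∀ n N : ℕ, ∃ N', N < N' ∧ ∀ i : Fin r, ∀ B ∈ (Finset.range (N + 1)).powerset,
      (∃ x, (∀ a ∈ B, a < x) ∧ insert x B ∈ (W (κ i)).R) →
      ∀ f : X →L[ℝ] ℝ, ‖f‖ ≤ 1 → ∃ m, N < m ∧ m ≤ N' ∧
        |f ((W (κ i)).φ (insert m B)) - f ((W (κ i)).φ B)| ≤ η * (1 / 2) ^ n := by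
    intro n N
    have : ∀ᶠ N' in atTop, ∀ i : Fin r, ∀ B ∈ (Finset.range (N + 1)).powerset,
      (∃ x, (∀ a ∈ B, a < x) ∧ insert x B ∈ (W (κ i)).R) →
      ∀ f : X →L[ℝ] ℝ, ‖f‖ ≤ 1 → ∃ m, N < m ∧ m ≤ N' ∧
        |f ((W (κ i)).φ (insert m B)) - f ((W (κ i)).φ B)| ≤ η * (1 / 2) ^ n := by
      rw [eventually_all]
      intro i
      rw [Finset.eventually_all]
      intro B _
      by_cases hB : ∃ x, (∀ a ∈ B, a < x) ∧ insert x B ∈ (W (κ i)).R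
      · obtain ⟨x, hx1, hx2⟩ := hB
        filter_upwards [(W (κ i)).eventually_exists_abs_sub_le hx1 hx2
          (show 0 < η * (1 / 2) ^ n by positivity) N] with N' hN' _
        exact hN'
      · exact Eventually.of_forall fun _ h => absurd h hB
    exact ((eventually_gt_atTop N).and this).exists
  choose F hF1 hF2 using key
  let b : ℕ → ℕ := fun n => Nat.rec n₀ (fun n N => F n N) n
  refine ⟨b, strictMono_nat_of_lt_succ fun n => hF1 n (b n), le_rfl, fun n i B hB => ?_⟩
  exact hF2 n (b n) i B (Finset.mem_powerset.2 hB)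

/-- The branch takes one point from every `r`-th block. Starting from the value 0 at `∅`, the
changes of `f` along it sum to at most `2 * η`. -/
theorem exists_path {W : WeakSystem X} (hW : W.φ ∅ = 0) {r : ℕ} (hr : 0 < r) (i : ℕ) (hi : i < r)
    {b : ℕ → ℕ} (hb : StrictMono b) {η : ℝ} (hη : 0 ≤ η) {f : X →L[ℝ] ℝ}
    (h : ∀ n, ∀ B ⊆ Finset.range (b n + 1),
      (∃ x, (∀ a ∈ B, a < x) ∧ insert x B ∈ W.R) → ∃ m, b n < m ∧ m ≤ b (n + 1) ∧
        |f (W.φ (insert m B)) - f (W.φ B)| ≤ η * (1 / 2) ^ n) :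
    ∃ q : ℕ → ℕ, StrictMono q ∧ (∀ j, b (j * r + i) < q j ∧ q j ≤ b (j * r + i + 1)) ∧
      |f (W.φ (W.top q))| ≤ 2 * η := by
  obtain ⟨q, hq⟩ := exists_seq_init
    (fun j B m => b (j * r + i) < m ∧ m ≤ b (j * r + i + 1) ∧
      (B ⊆ Finset.range (b (j * r + i) + 1) → (∃ x, (∀ a ∈ B, a < x) ∧ insert x B ∈ W.R) →
        |f (W.φ (insert m B)) - f (W.φ B)| ≤ η * (1 / 2) ^ (j * r + i)))
    (fun j B => by
      by_cases hB : B ⊆ Finset.range (b (j * r + i) + 1) ∧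
        ∃ x, (∀ a ∈ B, a < x) ∧ insert x B ∈ W.R
      · obtain ⟨m, h1, h2, h3⟩ := h _ B hB.1 hB.2
        exact ⟨m, h1, h2, fun _ _ => h3⟩
      -- Once no extension in the tree is possible, any point of the block serves to prolong the
      -- sequence.
      · exact ⟨b (j * r + i + 1), hb (Nat.lt_succ_self _), le_rfl,
          fun h1 h2 => absurd ⟨h1, h2⟩ hB⟩)
  have hbr : ∀ j, b (j * r + i + 1) ≤ b ((j + 1) * r + i) := fun j => hb.monotone (by
    rw [add_mul]; omega)
  have hqm : StrictMono q := strictMono_nat_of_lt_succ fun j =>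
    (hq j).2.1.trans_lt ((hbr j).trans_lt (hq (j + 1)).1)
  refine ⟨q, hqm, fun j => ⟨(hq j).1, (hq j).2.1⟩, ?_⟩
  have hsum : ∀ j ≤ W.cut q, |f (W.φ (init q j))| ≤ 2 * η * (1 - (1 / 2) ^ j) := by
    intro j
    induction j with
    | zero => simp [hW]
    | succ j ih =>
      intro hj
      have h1 := ih (by omega)
      have h2 := (hq j).2.2 (by
        intro a ha
        obtain ⟨l, hl, rfl⟩ := mem_init.1 ha
        rw [Finset.mem_range, Nat.lt_succ_iff]
        refine (hq l).2.1.trans (hb.monotone ?_)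
        have := Nat.mul_le_mul_right r hl
        rw [Nat.succ_mul] at this
        omega) ⟨q j, fun a ha => lt_of_mem_init hqm ha, by
          rw [← init_succ]
          exact W.init_mem_of_le_cut hqm hj⟩
      rw [← init_succ] at h2
      have h3 : η * (1 / 2) ^ (j * r + i) ≤ η * (1 / 2 : ℝ) ^ j := by
        gcongr ?_ * ?_
        refine pow_le_pow_of_le_one (by norm_num) (by norm_num) ?_
        have := Nat.le_mul_of_pos_right j hr
        omega
      have h4 := abs_sub_abs_le_abs_sub (f (W.φ (init q (j + 1)))) (f (W.φ (init q j)))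
      rw [pow_succ]
      linarith
  refine (hsum _ le_rfl).trans ?_
  have : (0 : ℝ) ≤ (1 / 2) ^ W.cut q := by positivity
  nlinarith

/-- Far enough there are arrays in which the terms outside `J` can be suppressed without
essentially increasing the norm. -/
theorem exists_suppression (W : ℕ → WeakSystem X) (hW : ∀ k, (W k).φ ∅ = 0) {r : ℕ} (hr : 0 < r)
    (κ : Fin r → ℕ) (A : Fin r → ℝ) (J : Finset (Fin r)) (n₀ : ℕ) {ε : ℝ} (hε : 0 < ε) :
    ∃ p : ℕ → ℕ, StrictMono p ∧ n₀ ≤ p 0 ∧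
      ‖∑ i ∈ J, A i • (W (κ i)).φ ((W (κ i)).top (strand r i p))‖ - ε ≤ ‖arraySum W κ A p‖ := by
  classical
  set S := ∑ i, |A i| with hS
  have hS0 : 0 ≤ S := Finset.sum_nonneg fun _ _ => abs_nonneg _
  set η := ε / (2 * (S + 1)) with hη
  have hη0 : 0 < η := by positivity
  obtain ⟨b, hb, hb0, hbl⟩ := exists_blocks W κ hη0 n₀
  have hpath := fun (i : Fin r) (f : X →L[ℝ] ℝ) (hf : ‖f‖ ≤ 1) =>
    exists_path (hW (κ i)) hr i i.2 hb hη0.le (f := f)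
      (fun n B h1 h2 => hbl n i B h1 h2 f hf)
  choose q hq1 hq2 hq3 using hpath
  -- The order of choices is decisive: branches in `J` are taken for the zero functional, where any
  -- branch would do. This fixes `v`, hence the norming functional `f`, and only then are the other
  -- branches chosen, for `f`.
  set v := ∑ i ∈ J, A i • (W (κ i)).φ ((W (κ i)).top (q i 0 (by simp))) with hv
  obtain ⟨f, hf, hfv⟩ := exists_dual_vector'' ℝ v
  let Q : Fin r → ℕ → ℕ := fun i => if i ∈ J then q i 0 (by simp) else q i f hf
  have hQ : ∀ (i : Fin r) j, b (j * r + i) < Q i j ∧ Q i j ≤ b (j * r + i + 1) := by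
    intro i j
    simp only [Q]
    split_ifs
    · exact hq2 _ _ _ _
    · exact hq2 _ _ _ _
  let p : ℕ → ℕ := fun n => Q ⟨n % r, Nat.mod_lt _ hr⟩ (n / r)
  have hpb : ∀ n, b n < p n ∧ p n ≤ b (n + 1) := by
    intro n
    have := hQ ⟨n % r, Nat.mod_lt _ hr⟩ (n / r)
    simpa only [Nat.div_add_mod'] using this
  have hp : StrictMono p := strictMono_nat_of_lt_succ fun n =>
    (hpb n).2.trans_lt (hpb (n + 1)).1
  have hstrand : ∀ i : Fin r, strand r i p = Q i := by
    intro i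
    ext j
    simp only [strand, p]
    have h1 : (j * r + (i : ℕ)) % r = i := by
      rw [Nat.mul_comm, Nat.mul_add_mod, Nat.mod_eq_of_lt i.2]
    have h2 : (j * r + (i : ℕ)) / r = j := by
      rw [Nat.mul_comm, Nat.mul_add_div hr, Nat.div_eq_of_lt i.2, Nat.add_zero]
    simp only [h1, h2]
  refine ⟨p, hp, hb0.trans (hpb 0).1.le, ?_⟩
  have hvJ : ∑ i ∈ J, A i • (W (κ i)).φ ((W (κ i)).top (strand r i p)) = v := by
    refine Finset.sum_congr rfl fun i hi => ?_
    rw [hstrand]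
    simp only [Q, hi, if_true]
  have hsplit : arraySum W κ A p = v +
      ∑ i ∈ Finset.univ \ J, A i • (W (κ i)).φ ((W (κ i)).top (strand r i p)) := by
    rw [arraySum, ← hvJ, add_comm, Finset.sum_sdiff (Finset.subset_univ J)]
  rw [hvJ, hsplit]
  have hrest : |f (∑ i ∈ Finset.univ \ J, A i • (W (κ i)).φ ((W (κ i)).top (strand r i p)))| ≤
      ε := by
    rw [map_sum]
    refine (Finset.abs_sum_le_sum_abs _ _).trans ?_
    have h1 : ∀ i ∈ Finset.univ \ J,
        |f (A i • (W (κ i)).φ ((W (κ i)).top (strand r i p)))| ≤ |A i| * (2 * η) := by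
      intro i hi
      have hiJ : i ∉ J := (Finset.mem_sdiff.1 hi).2
      rw [map_smul, smul_eq_mul, abs_mul, hstrand]
      simp only [Q, hiJ, if_false]
      gcongr
      exact hq3 i f hf
    refine (Finset.sum_le_sum h1).trans ?_
    rw [← Finset.sum_mul]
    calc (∑ i ∈ Finset.univ \ J, |A i|) * (2 * η) ≤ S * (2 * η) := by
          gcongr
          exact Finset.sum_le_sum_of_subset_of_nonneg (Finset.subset_univ _)
            fun _ _ _ => abs_nonneg _
      _ ≤ (S + 1) * (2 * η) := by gcongr; linarith
      _ = ε := by rw [hη]; field_simp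
  set w := ∑ i ∈ Finset.univ \ J, A i • (W (κ i)).φ ((W (κ i)).top (strand r i p))
  have h1 : f (v + w) ≤ ‖v + w‖ := by
    refine (le_abs_self _).trans ((f.le_opNorm _).trans ?_)
    calc ‖f‖ * ‖v + w‖ ≤ 1 * ‖v + w‖ := by gcongr
      _ = _ := one_mul _
  rw [map_add] at h1
  have h2 : f v = ‖v‖ := hfv
  have h3 := (abs_le.1 hrest).1
  linarith


/-! ### Plegma families inside increasing sequences -/

/-- The sets may have different sizes, so exhausted strands must be padded. Fewer than `r` padding
positions separate consecutive genuine entries, and the gaps of length `r` leave room for them. -/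
theorem exists_strand_eq {r : ℕ} (hr : 0 < r) {s : Fin r → Finset ℕ} (hs : IsPlegma s)
    (hgap : ∀ i j, ∀ a ∈ s i, ∀ b ∈ s j, a < b → a + r ≤ b) {n₀ : ℕ}
    (hn₀ : ∀ i, ∀ a ∈ s i, n₀ ≤ a) :
    ∃ p : ℕ → ℕ, StrictMono p ∧ n₀ ≤ p 0 ∧
      ∀ i : Fin r, init (strand r i p) (s i).card = s i := by
  classical
  let S : ℕ → Finset ℕ := fun n => s ⟨n % r, Nat.mod_lt _ hr⟩
  let real : ℕ → Prop := fun n => n / r < (S n).card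
  let val : ℕ → ℕ := fun n => elt (S n : Set ℕ) (n / r)
  let p : ℕ → ℕ := fun n => Nat.rec (val 0) (fun n x => if real (n + 1) then val (n + 1) else x + 1) n
  have hp0 : p 0 = val 0 := rfl
  have hp1 : ∀ n, p (n + 1) = if real (n + 1) then val (n + 1) else p n + 1 := fun n => rfl
  have hreal0 : ∀ n, n < r → real n := by
    intro n hn
    simp only [real, Nat.div_eq_of_lt hn]
    exact Finset.card_pos.2 (hs.nonempty _)
  have hreal_sub : ∀ n, real (n + r) → real n := by
    intro n hn
    simp only [real, S, Nat.add_mod_right, Nat.add_div_right _ hr] at hn ⊢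
    omega
  have hval_mem : ∀ n, real n → val n ∈ S n := fun n hn => elt_mem hn
  have hval_lt : ∀ m n, real m → real n → m < n → n ≤ m + r → val m < val n := by
    intro m n hm hn hmn hnm
    have h1 : m / r ≤ n / r := Nat.div_le_div_right hmn.le
    have h2 : n / r ≤ m / r + 1 := by
      rw [← Nat.add_div_right _ hr]
      exact Nat.div_le_div_right hnm
    rcases h1.eq_or_lt with h | h
    · have h3 := Nat.div_add_mod m r
      have h4 := Nat.div_add_mod n r
      rw [← h] at h4
      have h5 : m % r < n % r := by omega
      have := hs.lt_same ⟨m % r, Nat.mod_lt _ hr⟩ ⟨n % r, Nat.mod_lt _ hr⟩ h5 (m / r) hm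
        (by rw [h]; exact hn)
      simp only [val, S]
      rwa [← h]
    · have h3 : n / r = m / r + 1 := by omega
      have := hs.lt_succ ⟨m % r, Nat.mod_lt _ hr⟩ ⟨n % r, Nat.mod_lt _ hr⟩ (m / r) hm
        (by rw [← h3]; exact hn)
      simp only [val, S]
      rwa [h3]
  -- Padding counts up by one from the last genuine entry, at position `m`.
  have hinv : ∀ n, ∃ m ≤ n, real m ∧ (∀ m', m < m' → m' ≤ n → ¬ real m') ∧
      p n = val m + (n - m) := by
    intro n
    induction n with
    | zero => exact ⟨0, le_rfl, hreal0 0 hr, fun m' h h' => by omega, by simp [hp0]⟩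
    | succ n ih =>
      by_cases hn : real (n + 1)
      · exact ⟨n + 1, le_rfl, hn, fun m' h h' => by omega, by simp [hp1, hn]⟩
      · obtain ⟨m, hm, hrm, hno, hpm⟩ := ih
        refine ⟨m, by omega, hrm, fun m' h h' => ?_, ?_⟩
        · rcases h'.eq_or_lt with rfl | h''
          · exact hn
          · exact hno m' h (by omega)
        · rw [hp1, if_neg hn, hpm]
          omega
  have hreal : ∀ n, real n → p n = val n := by
    intro n hn
    cases n with
    | zero => rfl
    | succ n => rw [hp1, if_pos hn]
  have hp : StrictMono p := by
    apply strictMono_nat_of_lt_succ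
    intro n
    by_cases hn : real (n + 1)
    · obtain ⟨m, hm, hrm, hno, hpm⟩ := hinv n
      -- If position `n + 1` is genuine, so is the one `r` places earlier in the same strand; thus
      -- the last genuine position is at most `r` away.
      have hmr : n + 1 ≤ m + r := by
        by_contra! h
        obtain ⟨x, hx⟩ := Nat.exists_eq_add_of_le (show r ≤ n + 1 by omega)
        rw [Nat.add_comm] at hx
        exact hno x (by omega) (by omega) (hreal_sub x (by rw [Nat.add_comm x r, ← hx, Nat.add_comm]; exact hn))
      have h1 := hval_lt m (n + 1) hrm hn (by omega) hmr
      have h2 := hgap _ _ _ (hval_mem m hrm) _ (hval_mem (n + 1) hn) h1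
      rw [hp1, if_pos hn, hpm]
      omega
    · rw [hp1, if_neg hn]
      omega
  refine ⟨p, hp, hn₀ _ _ (hval_mem 0 (hreal0 0 hr)), fun i => init_eq_of_elt fun q hq => ?_⟩
  have h1 : (q * r + (i : ℕ)) % r = i := by
    rw [Nat.mul_comm, Nat.mul_add_mod, Nat.mod_eq_of_lt i.2]
  have h2 : (q * r + (i : ℕ)) / r = q := by
    rw [Nat.mul_comm, Nat.mul_add_div hr, Nat.div_eq_of_lt i.2, Nat.add_zero]
  have hS : S (q * r + i) = s i := by simp only [S, h1]
  have : real (q * r + i) := by simpa only [real, hS, h2] using hq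
  rw [strand, hreal _ this]
  simp only [val, hS, h2]

theorem IsPlegma.trunc (T : RankedTree) {l : ℕ} {t : Fin l → Finset ℕ} (ht : IsPlegma t) :
    IsPlegma fun j => T.trunc (t j) where
  nonempty j := T.trunc_nonempty (ht.nonempty j)
  lt_same i j hij k hi hj := by
    rw [T.elt_trunc hi, T.elt_trunc hj]
    exact ht.lt_same i j hij k (hi.trans_le (Finset.card_le_card (T.trunc_subset _)))
      (hj.trans_le (Finset.card_le_card (T.trunc_subset _)))
  lt_succ i j k hi hj := by
    rw [T.elt_trunc hi, T.elt_trunc hj]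
    exact ht.lt_succ i j k (hi.trans_le (Finset.card_le_card (T.trunc_subset _)))
      (hj.trans_le (Finset.card_le_card (T.trunc_subset _)))

/-- Strictly increasing maps whose values interlace with large gaps. -/
def spreadMap (k n : ℕ) : ℕ := (n ^ 2 + k) ^ 2

theorem strictMono_spreadMap (k : ℕ) : StrictMono (spreadMap k) := fun a b hab => by
  simp only [spreadMap]
  gcongr

/-- For `k ≤ n` one has `n² + k ≤ n² + n < (n + 1)²`, so the inner square separates the values at
different arguments. -/
theorem spreadMap_lt_spreadMap {k k' n n' : ℕ} (hnn : n < n') (hk : k ≤ n) :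
    spreadMap k n < spreadMap k' n' := by
  simp only [spreadMap]
  have : n ^ 2 + k < n' ^ 2 + k' := by nlinarith
  gcongr

/-- The outer square turns a difference of at least 1 into one of at least `2(n² + k) + 1`. -/
theorem spreadMap_gap {k k' n n' r : ℕ} (hr : r ≤ n) (h : spreadMap k n < spreadMap k' n') :
    spreadMap k n + r ≤ spreadMap k' n' := by
  simp only [spreadMap] at h ⊢
  have h1 : n ^ 2 + k < n' ^ 2 + k' := lt_of_pow_lt_pow_left₀ 2 (Nat.zero_le _) h
  have h2 : n ≤ n ^ 2 := Nat.le_self_pow (by norm_num) n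
  nlinarith

/-- The pullback of the `k`-th system along the `k`-th spreading map. -/
def interlaced (W : ℕ → WeakSystem X) (k : ℕ) : WeakSystem X :=
  (W k).comap (spreadMap k) (strictMono_spreadMap k)

/-- All truncations of `t` with small enough index are terminal. -/
def Admissible (V : ℕ → WeakSystem X) (t : Finset ℕ) : Prop :=
  ∀ k, (∀ a ∈ t, k ≤ a) → (V k).Terminal ((V k).trunc t)

/-- An index `x` encodes a pair: the member `x.divNat` of the plegma family and the system
`x.modNat`. In this lexicographic order the spread truncations form a plegma family with gaps of at
least `l * N`. They are thus initial segments of strands, and terminality identifies them as tops.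
-/
theorem exists_array_top (W : ℕ → WeakSystem X) {l N : ℕ} (hlN : 0 < l * N)
    {t : Fin l → Finset ℕ} (ht : IsPlegma t) (hadm : ∀ j, Admissible (interlaced W) (t j))
    {n₀ : ℕ} (hN : N ≤ n₀) (hr : l * N ≤ n₀) (hn₀ : ∀ j, ∀ m ∈ t j, n₀ ≤ m) :
    ∃ p : ℕ → ℕ, StrictMono p ∧ n₀ ≤ p 0 ∧ ∀ x : Fin (l * N),
      (W x.modNat).top (strand (l * N) x p) =
        ((interlaced W x.modNat).trunc (t x.divNat)).image (spreadMap x.modNat) := by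
  let s : Fin (l * N) → Finset ℕ := fun x =>
    ((interlaced W x.modNat).trunc (t x.divNat)).image (spreadMap x.modNat)
  have hcard : ∀ x, (s x).card = ((interlaced W x.modNat).trunc (t x.divNat)).card := fun x =>
    Finset.card_image_of_injective _ (strictMono_spreadMap _).injective
  have hcard' : ∀ x, (s x).card ≤ (t x.divNat).card := fun x =>
    (hcard x).trans_le (Finset.card_le_card (RankedTree.trunc_subset _ _))
  have helt : ∀ x q, q < (s x).card →
      elt (s x : Set ℕ) q = spreadMap x.modNat (elt (t x.divNat : Set ℕ) q) := by
    intro x q hq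
    rw [hcard] at hq
    rw [elt_image (strictMono_spreadMap _) hq, RankedTree.elt_trunc _ hq]
  have hmod : ∀ x : Fin (l * N), ∀ q < (t x.divNat).card,
      (x.modNat : ℕ) ≤ elt (t x.divNat : Set ℕ) q := by
    intro x q hq
    have := hn₀ _ _ (elt_mem hq)
    have := x.modNat.2
    omega
  have hs : IsPlegma s := by
    refine ⟨fun x => ?_, fun x y hxy q hx hy => ?_, fun x y q hx hy => ?_⟩
    · exact Finset.Nonempty.image (RankedTree.trunc_nonempty _ (ht.nonempty _)) _
    · rw [helt x q hx, helt y q hy]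
      have hx' := hx.trans_le (hcard' x)
      have hy' := hy.trans_le (hcard' y)
      have hxy' : (x : ℕ) < y := hxy
      have e1 := Nat.div_add_mod (x : ℕ) N
      have e2 := Nat.div_add_mod (y : ℕ) N
      rcases (Nat.div_le_div_right hxy'.le : (x : ℕ) / N ≤ (y : ℕ) / N).eq_or_lt with h | h
      · have hdiv : x.divNat = y.divNat := Fin.ext h
        have hlt : (x.modNat : ℕ) < y.modNat := by
          simp only [Fin.coe_modNat]
          rw [h] at e1
          omega
        rw [hdiv]
        simp only [spreadMap]
        gcongr
      · exact spreadMap_lt_spreadMap (ht.lt_same _ _ h q hx' hy') (hmod x q hx')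
    · rw [helt x q hx, helt y (q + 1) hy]
      have hx' := hx.trans_le (hcard' x)
      have hy' := hy.trans_le (hcard' y)
      exact spreadMap_lt_spreadMap (ht.lt_succ _ _ q hx' hy') (hmod x q hx')
  have hmem : ∀ x, ∀ a ∈ s x, ∃ n ∈ t x.divNat, spreadMap x.modNat n = a := by
    intro x a ha
    obtain ⟨n, hn, rfl⟩ := Finset.mem_image.1 ha
    exact ⟨n, RankedTree.trunc_subset _ _ hn, rfl⟩
  obtain ⟨p, hp, hp0, hps⟩ := exists_strand_eq hlN hs
    (fun x y a ha b hb hab => by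
      obtain ⟨n, hn, rfl⟩ := hmem x a ha
      obtain ⟨n', hn', rfl⟩ := hmem y b hb
      exact spreadMap_gap (hr.trans (hn₀ _ _ hn)) hab) (n₀ := n₀)
    (fun x a ha => by
      obtain ⟨n, hn, rfl⟩ := hmem x a ha
      exact (hn₀ _ _ hn).trans (strictMono_spreadMap _).le_apply)
  refine ⟨p, hp, hp0, fun x => ?_⟩
  have hterm : (W x.modNat).Terminal (s x) := by
    have := hadm x.divNat x.modNat (fun a ha => by
      have := hn₀ _ _ ha
      have := x.modNat.2
      omega)
    exact (RankedTree.terminal_comap_iff _ (strictMono_spreadMap _)).1 this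
  rw [← hps x] at hterm
  rw [(W x.modNat).top_eq_of_terminal (strictMono_strand hlN x hp) hterm, hps x]

/-! ### The combined family -/

/-- The combination with coefficients `d k` of the values of the systems `V k`. -/
noncomputable def combine (V : ℕ → WeakSystem X) (d : ℕ → ℝ) (t : Finset ℕ) : X :=
  ∑ k ∈ Finset.range (sInf (t : Set ℕ)), d k • (V k).φ ((V k).trunc t)

/-- The norms of linear combinations over plegma families with the property `P` converge to the
norms of the same combinations of `u`. -/
def AsymptoticTo (P : Finset ℕ → Prop) (y : Finset ℕ → X) {E : Type*} [SeminormedAddCommGroup E]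
    [NormedSpace ℝ E] (u : ℕ → E) : Prop :=
  ∀ (l : ℕ) (a : Fin l → ℝ), ∀ ε > 0, ∃ n₀ : ℕ, ∀ s : Fin l → Finset ℕ, (∀ j, P (s j)) →
    IsPlegma s → (∀ j, ∀ m ∈ s j, n₀ ≤ m) →
      |‖∑ j, a j • y (s j)‖ - ‖∑ j : Fin l, a j • u (j : ℕ)‖| ≤ ε

theorem exists_sum_Ico_le {d : ℕ → ℝ} (hd : ∀ k, 0 < d k) (hsum : Summable d) {ε : ℝ}
    (hε : 0 < ε) (N₁ : ℕ) : ∃ N ≥ N₁, ∀ m, ∑ k ∈ Finset.Ico N m, d k ≤ ε := by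
  have h1 := hsum.hasSum.tendsto_sum_nat
  obtain ⟨N, hN1, hN2⟩ := ((h1.eventually (lt_mem_nhds (sub_lt_self (∑' k, d k) hε))).and
    (eventually_ge_atTop N₁)).exists
  refine ⟨N, hN2, fun m => ?_⟩
  rcases le_total N m with h | h
  · rw [Finset.sum_Ico_eq_sub _ h]
    have := hsum.sum_le_tsum (Finset.range m) (fun i _ => (hd i).le)
    linarith
  · rw [Finset.Ico_eq_empty_of_le h, Finset.sum_empty]
    exact hε.le

theorem norm_combine_le {V : ℕ → WeakSystem X} {C : ℝ}
    (hC : ∀ k, ∀ t ∈ (V k).R, ‖(V k).φ t‖ ≤ C) {d : ℕ → ℝ} (hd : ∀ k, 0 < d k)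
    (hsum : Summable d) (t : Finset ℕ) : ‖combine V d t‖ ≤ (∑' k, d k) * C := by
  have hC0 : 0 ≤ C := (norm_nonneg _).trans (hC 0 ∅ (V 0).empty_mem)
  refine (norm_sum_le _ _).trans ?_
  calc ∑ k ∈ Finset.range (sInf (t : Set ℕ)), ‖d k • (V k).φ ((V k).trunc t)‖
      ≤ ∑ k ∈ Finset.range (sInf (t : Set ℕ)), d k * C := by
        refine Finset.sum_le_sum fun k _ => ?_
        rw [norm_smul, Real.norm_eq_abs, abs_of_pos (hd k)]
        exact mul_le_mul_of_nonneg_left (hC k _ ((V k).trunc_mem t)) (hd k).le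
    _ ≤ (∑' k, d k) * C := by
        rw [← Finset.sum_mul]
        exact mul_le_mul_of_nonneg_right (hsum.sum_le_tsum _ fun i _ => (hd i).le) hC0

theorem le_sInf_of_forall {t : Finset ℕ} (ht : t.Nonempty) {N : ℕ} (h : ∀ m ∈ t, N ≤ m) :
    N ≤ sInf (t : Set ℕ) := le_csInf (by simpa using ht) h

/-- The number of summands in `combine` grows with `min t`, but the tail of `d` is small uniformly,
so a fixed number suffices and stability of finite arrays becomes applicable. -/
theorem exists_norm_combine_sub_le {V : ℕ → WeakSystem X} {C : ℝ}
    (hC : ∀ k, ∀ t ∈ (V k).R, ‖(V k).φ t‖ ≤ C) {d : ℕ → ℝ} (hd : ∀ k, 0 < d k)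
    (hsum : Summable d) {l : ℕ} (a : Fin l → ℝ) {ε : ℝ} (hε : 0 < ε) (N₁ : ℕ) :
    ∃ N ≥ N₁, ∀ t : Fin l → Finset ℕ, (∀ j, (t j).Nonempty) → (∀ j, ∀ m ∈ t j, N ≤ m) →
      ‖∑ j, a j • combine V d (t j) -
        ∑ j, a j • ∑ k ∈ Finset.range N, d k • (V k).φ ((V k).trunc (t j))‖ ≤ ε := by
  have hC0 : 0 ≤ C := (norm_nonneg _).trans (hC 0 ∅ (V 0).empty_mem)
  set S := ∑ j, |a j| with hS
  have hS0 : 0 ≤ S := Finset.sum_nonneg fun _ _ => abs_nonneg _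
  obtain ⟨N, hN1, hN2⟩ := exists_sum_Ico_le hd hsum
    (show 0 < ε / ((S + 1) * (C + 1)) by positivity) N₁
  refine ⟨N, hN1, fun t hne ht => ?_⟩
  rw [← Finset.sum_sub_distrib]
  have h1 : ∀ j ∈ Finset.univ, ‖a j • combine V d (t j) -
      a j • ∑ k ∈ Finset.range N, d k • (V k).φ ((V k).trunc (t j))‖ ≤
      |a j| * (ε / ((S + 1) * (C + 1)) * C) := by
    intro j _
    rw [← smul_sub, norm_smul, Real.norm_eq_abs]
    refine mul_le_mul_of_nonneg_left ?_ (abs_nonneg _)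
    have hNle := le_sInf_of_forall (hne j) (ht j)
    rw [combine, ← Finset.sum_Ico_eq_sub _ hNle]
    refine (norm_sum_le _ _).trans ?_
    calc ∑ k ∈ Finset.Ico N (sInf (t j : Set ℕ)), ‖d k • (V k).φ ((V k).trunc (t j))‖
        ≤ ∑ k ∈ Finset.Ico N (sInf (t j : Set ℕ)), d k * C := by
          refine Finset.sum_le_sum fun k _ => ?_
          rw [norm_smul, Real.norm_eq_abs, abs_of_pos (hd k)]
          exact mul_le_mul_of_nonneg_left (hC k _ ((V k).trunc_mem _)) (hd k).le
      _ ≤ ε / ((S + 1) * (C + 1)) * C := by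
          rw [← Finset.sum_mul]
          exact mul_le_mul_of_nonneg_right (hN2 _) hC0
  refine (norm_sum_le _ _).trans ((Finset.sum_le_sum h1).trans ?_)
  rw [← Finset.sum_mul]
  calc S * (ε / ((S + 1) * (C + 1)) * C) ≤ (S + 1) * (ε / ((S + 1) * (C + 1)) * (C + 1)) := by
        gcongr <;> linarith
    _ = ε := by field_simp

theorem sum_combine_eq_arraySum (W : ℕ → WeakSystem X) (d : ℕ → ℝ) {l N : ℕ} (a : Fin l → ℝ)
    {t : Fin l → Finset ℕ} {p : ℕ → ℕ}
    (hp : ∀ x : Fin (l * N), (W x.modNat).top (strand (l * N) x p) =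
        ((interlaced W x.modNat).trunc (t x.divNat)).image (spreadMap x.modNat)) :
    ∑ j, a j • ∑ k ∈ Finset.range N,
        d k • (interlaced W k).φ ((interlaced W k).trunc (t j)) =
      arraySum W (fun x : Fin (l * N) => x.modNat) (fun x => a x.divNat * d x.modNat) p := by
  rw [arraySum]
  let g : Fin l × Fin N → X := fun y =>
    a y.1 • d y.2 • (interlaced W y.2).φ ((interlaced W y.2).trunc (t y.1))
  have h1 : ∀ x : Fin (l * N), (a x.divNat * d x.modNat) •
      (W x.modNat).φ ((W x.modNat).top (strand (l * N) x p)) =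
      g (finProdFinEquiv.symm x) := by
    intro x
    rw [hp, mul_smul]
    rfl
  rw [Finset.sum_congr rfl fun x _ => h1 x, Equiv.sum_comp finProdFinEquiv.symm g,
    Fintype.sum_prod_type]
  refine Finset.sum_congr rfl fun j _ => ?_
  rw [Finset.smul_sum, Finset.sum_range]

/-! ### Asymptotic norms of the combined family. -/

section Combined

variable {W : ℕ → WeakSystem X} {C : ℝ} {d : ℕ → ℝ}

theorem interlaced_bound (hC : ∀ k, ∀ t ∈ (W k).R, ‖(W k).φ t‖ ≤ C) :
    ∀ k, ∀ t ∈ (interlaced W k).R, ‖(interlaced W k).φ t‖ ≤ C :=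
  fun k _ ht => hC k _ ht

/-- Up to the tails, both sides are norms of one and the same type of array, read along two
sequences, and these agree by stability. -/
theorem cauchy_norm_combine (hW : Stable W) (hC : ∀ k, ∀ t ∈ (W k).R, ‖(W k).φ t‖ ≤ C)
    (hd : ∀ k, 0 < d k) (hsum : Summable d) {l : ℕ} (a : Fin l → ℝ) {ε : ℝ} (hε : 0 < ε) :
    ∃ n₀, ∀ t t' : Fin l → Finset ℕ, (∀ j, Admissible (interlaced W) (t j)) →
      (∀ j, Admissible (interlaced W) (t' j)) → IsPlegma t → IsPlegma t' →
      (∀ j, ∀ m ∈ t j, n₀ ≤ m) → (∀ j, ∀ m ∈ t' j, n₀ ≤ m) →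
      |‖∑ j, a j • combine (interlaced W) d (t j)‖ -
        ‖∑ j, a j • combine (interlaced W) d (t' j)‖| ≤ ε := by
  rcases Nat.eq_zero_or_pos l with rfl | hl
  · exact ⟨0, fun t t' _ _ _ _ _ _ => by simpa using hε.le⟩
  obtain ⟨N, hN1, hN⟩ := exists_norm_combine_sub_le (interlaced_bound hC) hd hsum a
    (show 0 < ε / 3 by positivity) 1
  have hlN : 0 < l * N := Nat.mul_pos hl hN1
  obtain ⟨n₁, hn₁⟩ := hW (l * N) (fun x => x.modNat) (fun x => a x.divNat * d x.modNat) (ε / 3)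
    (by positivity)
  refine ⟨n₁ + N + l * N, fun t t' hadm hadm' ht ht' h h' => ?_⟩
  obtain ⟨p, hp, hp0, hpt⟩ := exists_array_top W hlN ht hadm (by omega) (by omega) h
  obtain ⟨p', hp', hp0', hpt'⟩ := exists_array_top W hlN ht' hadm' (by omega) (by omega) h'
  have e1 := hN t ht.nonempty fun j m hm => le_trans (by omega) (h j m hm)
  have e2 := hN t' ht'.nonempty fun j m hm => le_trans (by omega) (h' j m hm)
  rw [sum_combine_eq_arraySum W d a hpt] at e1
  rw [sum_combine_eq_arraySum W d a hpt'] at e2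
  have e3 := hn₁ p p' hp hp' (by omega) (by omega)
  have e4 := (abs_norm_sub_norm_le _ _).trans e1
  have e5 := (abs_norm_sub_norm_le _ _).trans e2
  rw [abs_le] at *
  constructor <;> linarith [e3.1, e3.2, e4.1, e4.2, e5.1, e5.2]

theorem norm_sum_mul_smul {E : Type*} [SeminormedAddCommGroup E] [NormedSpace ℝ E] {l : ℕ}
    (a : Fin l → ℝ) {c : ℝ} (hc : 0 ≤ c) (v : Fin l → E) :
    ‖∑ j, (a j * c) • v j‖ = c * ‖∑ j, a j • v j‖ := by
  have : ∑ j, (a j * c) • v j = c • ∑ j, a j • v j := by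
    rw [Finset.smul_sum]
    exact Finset.sum_congr rfl fun j _ => by rw [mul_comm, mul_smul]
  rw [this, norm_smul, Real.norm_eq_abs, abs_of_nonneg hc]

variable {E : ℕ → Type*} [∀ k, SeminormedAddCommGroup (E k)] [∀ k, NormedSpace ℝ (E k)]
  {e : ∀ k, ℕ → E k}

/-- Stability replaces the array of `t` by one in which all systems except the `k`-th can be
suppressed. The surviving terms belong to a plegma family of terminal nodes of `W k`, whose norm is
governed by `e k`. -/
theorem le_norm_combine (hW : Stable W) (hC : ∀ k, ∀ t ∈ (W k).R, ‖(W k).φ t‖ ≤ C)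
    (hW0 : ∀ k, (W k).φ ∅ = 0) (hWe : ∀ k, AsymptoticTo (W k).Terminal (W k).φ (e k))
    (hd : ∀ k, 0 < d k) (hsum : Summable d) {l : ℕ} (a : Fin l → ℝ) (k : ℕ) {ε : ℝ}
    (hε : 0 < ε) :
    ∃ n₀, ∀ t : Fin l → Finset ℕ, (∀ j, Admissible (interlaced W) (t j)) → IsPlegma t →
      (∀ j, ∀ m ∈ t j, n₀ ≤ m) →
      d k * ‖∑ j : Fin l, a j • e k j‖ - ε ≤ ‖∑ j, a j • combine (interlaced W) d (t j)‖ := by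
  rcases Nat.eq_zero_or_pos l with rfl | hl
  · exact ⟨0, fun t _ _ _ => by simpa using hε.le⟩
  obtain ⟨N, hkN, hN⟩ := exists_norm_combine_sub_le (interlaced_bound hC) hd hsum a
    (show 0 < ε / 4 by positivity) (k + 1)
  have hN0 : 0 < N := by omega
  have hlN : 0 < l * N := Nat.mul_pos hl hN0
  set κ : Fin (l * N) → ℕ := fun x => x.modNat with hκ
  set A : Fin (l * N) → ℝ := fun x => a x.divNat * d x.modNat with hA
  obtain ⟨n₁, hn₁⟩ := hW (l * N) κ A (ε / 4) (by positivity)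
  obtain ⟨n₂, hn₂⟩ := hWe k l (fun j => a j * d k) (ε / 4) (by positivity)
  -- The positions of the `k`-th system in the array.
  let g : Fin l → Fin (l * N) := fun j => finProdFinEquiv (j, ⟨k, hkN⟩)
  have hg : ∀ j, (g j : ℕ) = k + N * j := fun j => rfl
  have hginj : Function.Injective g := fun i j h => by
    have := congrArg Fin.val h
    rw [hg, hg] at this
    exact Fin.ext (Nat.eq_of_mul_eq_mul_left hN0 (by omega))
  have hgm : ∀ j, (g j).modNat = ⟨k, hkN⟩ := fun j =>
    congrArg Prod.snd (finProdFinEquiv.symm_apply_apply (j, (⟨k, hkN⟩ : Fin N)))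
  have hgd : ∀ j, (g j).divNat = j := fun j =>
    congrArg Prod.fst (finProdFinEquiv.symm_apply_apply (j, (⟨k, hkN⟩ : Fin N)))
  obtain ⟨q, hq, hq0, hqs⟩ := exists_suppression W hW0 hlN κ A (Finset.univ.image g)
    (max n₁ n₂) (show 0 < ε / 4 by positivity)
  refine ⟨n₁ + N + l * N, fun t hadm ht h => ?_⟩
  obtain ⟨p, hp, hp0, hpt⟩ := exists_array_top W hlN ht hadm (by omega) (by omega) h
  have e1 := hN t ht.nonempty fun j m hm => le_trans (by omega) (h j m hm)
  rw [sum_combine_eq_arraySum W d a hpt] at e1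
  have e2 := (abs_norm_sub_norm_le _ _).trans e1
  have e3 := hn₁ p q hp hq (by omega) (by omega)
  have hsumJ : ∑ x ∈ Finset.univ.image g, A x • (W (κ x)).φ ((W (κ x)).top (strand (l * N) x q)) =
      ∑ j, (a j * d k) • (W k).φ ((W k).top (strand (l * N) (g j) q)) := by
    rw [Finset.sum_image fun i _ j _ h => hginj h]
    refine Finset.sum_congr rfl fun j _ => ?_
    simp only [hA, hκ, hgm, hgd]
  rw [hsumJ] at hqs
  have hsm : ∀ j : Fin l, StrictMono (strand (l * N) (g j) q) := fun j =>
    strictMono_strand hlN _ hq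
  have e4 := hn₂ (fun j => (W k).top (strand (l * N) (g j) q))
    (fun j => (W k).terminal_top (hsm j))
    (isPlegma_init hsm (fun j => (W k).cut_pos (hsm j))
      (fun i j hij m => hq (by
        have := Nat.mul_lt_mul_of_pos_left (show (i : ℕ) < j from hij) hN0
        rw [hg, hg]
        omega))
      (fun i j m => hq (by
        have := (g i).2
        rw [add_mul]
        omega)))
    (fun j m hm => by
      obtain ⟨i, -, rfl⟩ := mem_init.1 hm
      exact (le_max_right n₁ n₂).trans (hq0.trans (hq.monotone (Nat.zero_le _))))
  rw [norm_sum_mul_smul a (hd k).le (fun j : Fin l => e k j)] at e4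
  rw [abs_le] at *
  linarith [e2.1, e3.1, e4.1]

/-- Triangle inequality over the systems, after cutting to `N` of them; each contributes an error of
at most `ε / (2 * N)`. -/
theorem norm_combine_le_tsum (hC : ∀ k, ∀ t ∈ (W k).R, ‖(W k).φ t‖ ≤ C)
    (hWe : ∀ k, AsymptoticTo (W k).Terminal (W k).φ (e k))
    (hd : ∀ k, 0 < d k) (hsum : Summable d) {l : ℕ} (a : Fin l → ℝ)
    (hsum' : Summable fun k => d k * ‖∑ j : Fin l, a j • e k j‖) {ε : ℝ} (hε : 0 < ε) :
    ∃ n₀, ∀ t : Fin l → Finset ℕ, (∀ j, Admissible (interlaced W) (t j)) → IsPlegma t →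
      (∀ j, ∀ m ∈ t j, n₀ ≤ m) →
      ‖∑ j, a j • combine (interlaced W) d (t j)‖ ≤
        ∑' k, d k * ‖∑ j : Fin l, a j • e k j‖ + ε := by
  obtain ⟨N, hN1, hN⟩ := exists_norm_combine_sub_le (interlaced_bound hC) hd hsum a
    (show 0 < ε / 2 by positivity) 1
  have hN0 : (0 : ℝ) < N := by exact_mod_cast hN1
  choose n hn using fun k => hWe k l (fun j => a j * d k) (ε / (2 * N)) (by positivity)
  refine ⟨N + ∑ k ∈ Finset.range N, n k, fun t hadm ht h => ?_⟩
  have e1 := hN t ht.nonempty fun j m hm => le_trans (by omega) (h j m hm)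
  have e2 := (abs_le.1 ((abs_norm_sub_norm_le _ _).trans e1)).2
  have e3 : ∀ k ∈ Finset.range N,
      ‖∑ j, (a j * d k) • (interlaced W k).φ ((interlaced W k).trunc (t j))‖ ≤
      d k * ‖∑ j : Fin l, a j • e k j‖ + ε / (2 * N) := by
    intro k hk
    have hkn : n k ≤ ∑ k ∈ Finset.range N, n k :=
      Finset.single_le_sum (f := n) (fun _ _ => Nat.zero_le _) hk
    rw [Finset.mem_range] at hk
    have := hn k (fun j => ((interlaced W k).trunc (t j)).image (spreadMap k))
      (fun j => (RankedTree.terminal_comap_iff _ (strictMono_spreadMap _)).1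
        (hadm j k fun a ha => by have := h j a ha; omega))
      ((isPlegma_image_iff (strictMono_spreadMap k)).2 (ht.trunc _))
      (fun j m hm => by
        obtain ⟨b, hb, rfl⟩ := Finset.mem_image.1 hm
        have h1 := h j b (RankedTree.trunc_subset _ _ hb)
        have h2 := (strictMono_spreadMap k).le_apply (x := b)
        omega)
    rw [norm_sum_mul_smul a (hd k).le (fun j : Fin l => e k j)] at this
    have h3 := (abs_le.1 this).2
    have h4 : ‖∑ j, (a j * d k) • (interlaced W k).φ ((interlaced W k).trunc (t j))‖ =
      ‖∑ j, (a j * d k) • (W k).φ (((interlaced W k).trunc (t j)).image (spreadMap k))‖ := rfl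
    rw [h4]
    linarith
  have e4 : ∑ j, a j • ∑ k ∈ Finset.range N,
      d k • (interlaced W k).φ ((interlaced W k).trunc (t j)) =
      ∑ k ∈ Finset.range N, ∑ j, (a j * d k) •
        (interlaced W k).φ ((interlaced W k).trunc (t j)) := by
    rw [Finset.sum_comm]
    refine Finset.sum_congr rfl fun j _ => ?_
    rw [Finset.smul_sum]
    exact Finset.sum_congr rfl fun k _ => by rw [mul_smul]
  rw [e4] at e2
  have e5 := (norm_sum_le _ _).trans (Finset.sum_le_sum e3)
  rw [Finset.sum_add_distrib, Finset.sum_const, Finset.card_range, nsmul_eq_mul] at e5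
  have e6 := hsum'.sum_le_tsum (Finset.range N)
    (fun k _ => mul_nonneg (hd k).le (norm_nonneg _))
  have e7 : (N : ℝ) * (ε / (2 * N)) = ε / 2 := by field_simp
  linarith

end Combined


/-! ### From asymptotic norms to spreading models and back -/

theorem sum_fin_eq_of_support {E : Type*} [AddCommGroup E] [Module ℝ E] (b : ℕ →₀ ℝ) {l n : ℕ}
    (hl : ∀ j, l ≤ j → b j = 0) (hln : l ≤ n) (v : Fin n → E) :
    ∑ j : Fin n, b j • v j = ∑ j : Fin l, b j • v (Fin.castLE hln j) := by
  rw [← Finset.sum_subset (Finset.subset_univ (Finset.univ.map (Fin.castLEEmb hln)))]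
  · rw [Finset.sum_map]
    rfl
  · intro j _ hj
    rw [hl j, zero_smul]
    by_contra! h
    exact hj (Finset.mem_map.2 ⟨⟨j, h⟩, Finset.mem_univ _, rfl⟩)

/-- If the norms of linear combinations over plegma families are asymptotically constant, then
they converge to the norm of a seminormed space with a Hamel basis. -/
theorem exists_basis_asymptoticTo {P : Finset ℕ → Prop} {y : Finset ℕ → X}
    (hcauchy : ∀ (l : ℕ) (a : Fin l → ℝ), ∀ ε > 0, ∃ n₀ : ℕ, ∀ s s' : Fin l → Finset ℕ,
      (∀ j, P (s j)) → (∀ j, P (s' j)) → IsPlegma s → IsPlegma s' →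
      (∀ j, ∀ m ∈ s j, n₀ ≤ m) → (∀ j, ∀ m ∈ s' j, n₀ ≤ m) →
      |‖∑ j, a j • y (s j)‖ - ‖∑ j, a j • y (s' j)‖| ≤ ε)
    (hex : ∀ l n : ℕ, ∃ s : Fin l → Finset ℕ, (∀ j, P (s j)) ∧ IsPlegma s ∧
      ∀ j, ∀ m ∈ s j, n ≤ m) :
    ∃ (E : Type) (_ : SeminormedAddCommGroup E) (_ : NormedSpace ℝ E) (u : Module.Basis ℕ ℝ E),
      AsymptoticTo P y u := by
  -- Test families of length `n` beyond `n`: the support of any fixed vector is eventually covered,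
  -- and the norms along them form a Cauchy sequence.
  choose tup htP htpl htn using fun n => hex n n
  let S : ℕ → (ℕ →₀ ℝ) → ℝ := fun n b => ‖∑ j : Fin n, b j • y (tup n j)‖
  have hbd : ∀ b : ℕ →₀ ℝ, ∃ l, ∀ j, l ≤ j → b j = 0 := fun b =>
    ⟨b.support.sup id + 1, fun j hj => by
      by_contra h
      have := Finset.le_sup (f := id) (Finsupp.mem_support_iff.2 h)
      simp only [id] at this
      omega⟩
  have hS : ∀ (b : ℕ →₀ ℝ) (l n : ℕ) (hln : l ≤ n), (∀ j, l ≤ j → b j = 0) →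
      S n b = ‖∑ j : Fin l, b j • y (tup n (Fin.castLE hln j))‖ := fun b l n hln hl => by
    simp only [S]
    rw [sum_fin_eq_of_support b hl hln]
  have hpl : ∀ (l n : ℕ) (hln : l ≤ n), IsPlegma fun j : Fin l => tup n (Fin.castLE hln j) :=
    fun l n hln => (htpl n).comp (Fin.strictMono_castLE hln)
  have hlim : ∀ b, ∃ x, Tendsto (fun n => S n b) atTop (𝓝 x) := by
    intro b
    apply cauchySeq_tendsto_of_complete
    obtain ⟨l, hl⟩ := hbd b
    rw [Metric.cauchySeq_iff]
    intro ε hε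
    obtain ⟨n₀, hn₀⟩ := hcauchy l (fun j => b j) (ε / 2) (half_pos hε)
    refine ⟨max l n₀, fun m hm n hn => ?_⟩
    have hlm := (le_max_left _ _).trans hm
    have hln := (le_max_left _ _).trans hn
    rw [hS b l m hlm hl, hS b l n hln hl, Real.dist_eq]
    refine (hn₀ _ _ (fun _ => htP _ _) (fun _ => htP _ _) (hpl l m hlm) (hpl l n hln)
      (fun j x hx => ?_) (fun j x hx => ?_)).trans_lt (half_lt_self hε)
    · exact (le_max_right _ _).trans (hm.trans (htn m _ x hx))
    · exact (le_max_right _ _).trans (hn.trans (htn n _ x hx))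
  choose L hL using hlim
  -- Subadditivity and homogeneity pass to the limit. Only a seminorm results, since the limit may
  -- vanish on nonzero vectors.
  let p : Seminorm ℝ (ℕ →₀ ℝ) := Seminorm.of L
    (fun b b' => le_of_tendsto_of_tendsto' (hL _) ((hL b).add (hL b')) fun n => by
      simp only [S, Finsupp.add_apply, add_smul, Finset.sum_add_distrib]
      exact norm_add_le _ _)
    (fun c b => tendsto_nhds_unique (hL _) (((hL b).const_mul ‖c‖).congr fun n => by
      simp only [S, Finsupp.smul_apply, smul_eq_mul, mul_smul, ← Finset.smul_sum]
      rw [norm_smul]))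
  let inst : SeminormedAddCommGroup (ℕ →₀ ℝ) := p.toAddGroupSeminorm.toSeminormedAddCommGroup
  let inst' : NormedSpace ℝ (ℕ →₀ ℝ) :=
    { (inferInstance : Module ℝ (ℕ →₀ ℝ)) with
      norm_smul_le := fun c b => (map_smul_eq_mul p c b).le }
  refine ⟨ℕ →₀ ℝ, inst, inst', Finsupp.basisSingleOne, fun l a ε hε => ?_⟩
  set b : ℕ →₀ ℝ := ∑ j : Fin l, a j • (Finsupp.basisSingleOne (R := ℝ) (j : ℕ)) with hb
  have hbj : ∀ i, b i = ∑ j : Fin l, if (j : ℕ) = i then a j else 0 := fun i => by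
    rw [hb, Finsupp.finsetSum_apply]
    refine Finset.sum_congr rfl fun j _ => ?_
    simp [Finsupp.single_apply]
  have hbl : ∀ j : Fin l, b j = a j := fun j => by
    rw [hbj, Finset.sum_eq_single j]
    · simp
    · intro i _ hij
      rw [if_neg fun h => hij (Fin.ext h)]
    · simp
  have hb0 : ∀ j, l ≤ j → b j = 0 := fun j hj => by
    rw [hbj]
    refine Finset.sum_eq_zero fun i _ => ?_
    rw [if_neg]
    have := i.2
    omega
  obtain ⟨n₀, hn₀⟩ := hcauchy l a ε hε
  refine ⟨n₀, fun s hsP hspl hs => ?_⟩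
  have hnorm : Tendsto (fun n => S n b) atTop (𝓝 ‖b‖) := hL b
  have hlim2 := (hnorm.const_sub ‖∑ j, a j • y (s j)‖).abs
  refine le_of_tendsto hlim2 ?_
  filter_upwards [eventually_ge_atTop (max l n₀)] with n hn
  have hln := (le_max_left _ _).trans hn
  rw [hS b l n hln hb0]
  simp only [hbl]
  exact hn₀ s _ hsP (fun _ => htP _ _) hspl (hpl l n hln) hs
    (fun j x hx => (le_max_right _ _).trans (hn.trans (htn n _ x hx)))

theorem abs_norm_sum_sub_norm_sum_le {E : Type*} [SeminormedAddCommGroup E] [NormedSpace ℝ E]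
    {l : ℕ} {a b : Fin l → ℝ} {v : Fin l → E} {η C : ℝ} (hη : ∀ j, |a j - b j| ≤ η)
    (hC : ∀ j, ‖v j‖ ≤ C) : |‖∑ j, a j • v j‖ - ‖∑ j, b j • v j‖| ≤ l * (η * C) := by
  refine (abs_norm_sub_norm_le _ _).trans ?_
  rw [← Finset.sum_sub_distrib]
  have : ∀ j ∈ Finset.univ, ‖a j • v j - b j • v j‖ ≤ η * C := fun j _ => by
    rw [← sub_smul, norm_smul, Real.norm_eq_abs]
    exact mul_le_mul (hη j) (hC j) (norm_nonneg _) ((abs_nonneg _).trans (hη j))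
  refine (norm_sum_le _ _).trans ((Finset.sum_le_sum this).trans ?_)
  simp

/-- Both norms are Lipschitz in the coefficients, so a finite net of the cube gives one threshold
for all coefficients. -/
theorem AsymptoticTo.uniform {P : Finset ℕ → Prop} {y : Finset ℕ → X} {C : ℝ}
    (hC : ∀ s, P s → ‖y s‖ ≤ C) {E : Type*} [SeminormedAddCommGroup E] [NormedSpace ℝ E]
    {u : ℕ → E} (h : AsymptoticTo P y u) (l : ℕ) {ε : ℝ} (hε : 0 < ε) :
    ∀ᶠ n₀ : ℕ in atTop, ∀ a : Fin l → ℝ, (∀ j, a j ∈ Set.Icc (-1 : ℝ) 1) →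
      ∀ s : Fin l → Finset ℕ, (∀ j, P (s j)) → IsPlegma s → (∀ j, ∀ m ∈ s j, n₀ ≤ m) →
        |‖∑ j, a j • y (s j)‖ - ‖∑ j : Fin l, a j • u (j : ℕ)‖| ≤ ε := by
  set D := max (max C 0) (∑ j : Fin l, ‖u j‖) with hD
  have hD0 : 0 ≤ D := (le_max_right C 0).trans (le_max_left _ _)
  set η := ε / (3 * ((l + 1) * (D + 1))) with hη
  have hη0 : 0 < η := by positivity
  have hlη : l * (η * D) ≤ ε / 3 := by
    calc l * (η * D) ≤ (l + 1) * (η * (D + 1)) := by gcongr <;> linarith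
      _ = ε / 3 := by rw [hη]; field_simp
  have hcomp : IsCompact (Set.pi Set.univ fun _ : Fin l => Set.Icc (-1 : ℝ) 1) :=
    isCompact_univ_pi fun _ => isCompact_Icc
  obtain ⟨t, -, htfin, htcov⟩ := hcomp.finite_cover_balls hη0
  have hev : ∀ᶠ n₀ : ℕ in atTop, ∀ b ∈ t,
      ∀ s : Fin l → Finset ℕ, (∀ j, P (s j)) → IsPlegma s → (∀ j, ∀ m ∈ s j, n₀ ≤ m) →
        |‖∑ j, b j • y (s j)‖ - ‖∑ j : Fin l, b j • u (j : ℕ)‖| ≤ ε / 3 := by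
    rw [eventually_all_finite htfin]
    intro b _
    obtain ⟨n₁, hn₁⟩ := h l b (ε / 3) (by positivity)
    filter_upwards [eventually_ge_atTop n₁] with n hn s h1 h2 h3
    exact hn₁ s h1 h2 fun j m hm => hn.trans (h3 j m hm)
  filter_upwards [hev] with n hn a ha s h1 h2 h3
  obtain ⟨b, hb, hab⟩ := Set.mem_iUnion₂.1 (htcov (show a ∈ Set.pi Set.univ _ from
    fun j _ => ha j))
  have hab' : ∀ j, |a j - b j| ≤ η := fun j => by
    rw [← Real.dist_eq]
    exact (dist_le_pi_dist a b j).trans (Metric.mem_ball.1 hab).le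
  have e1 := abs_norm_sum_sub_norm_sum_le (v := fun j => y (s j)) (C := D) hab' fun j =>
    (hC _ (h1 j)).trans ((le_max_left _ _).trans (le_max_left _ _))
  have e2 := abs_norm_sum_sub_norm_sum_le (v := fun j : Fin l => u j) (C := D) hab' fun j =>
    (Finset.single_le_sum (f := fun j : Fin l => ‖u j‖) (fun _ _ => norm_nonneg _)
      (Finset.mem_univ j)).trans (le_max_right _ _)
  have e3 := hn b hb s h1 h2 h3
  rw [abs_le] at *
  constructor <;> linarith [e1.1, e1.2, e2.1, e2.2, e3.1, e3.2]

theorem elt_zero_le {s : Finset ℕ} {m : ℕ} (hm : m ∈ s) : elt (s : Set ℕ) 0 ≤ m := by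
  obtain ⟨k, hk, rfl⟩ := exists_elt_eq hm
  rcases Nat.eq_zero_or_pos k with rfl | h
  · exact le_rfl
  · exact (elt_lt_elt h hk).le

theorem IsPlegma.le_of_le_elt {k n : ℕ} {s : Fin (k + 1) → Finset ℕ} (hs : IsPlegma s)
    (h : n ≤ elt (s 0 : Set ℕ) 0) (j : Fin (k + 1)) {m : ℕ} (hm : m ∈ s j) : n ≤ m := by
  refine le_trans ?_ (elt_zero_le hm)
  rcases eq_or_ne j 0 with rfl | hj
  · exact h
  · exact h.trans (hs.lt_same 0 j (Fin.pos_of_ne_zero hj) 0 (Finset.card_pos.2 (hs.nonempty _))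
      (Finset.card_pos.2 (hs.nonempty _))).le

/-- The set is thinned so that its term of index `l` exceeds the threshold for accuracy `1 / (l +
1)` and all lengths up to `l + 1`. -/
theorem AsymptoticTo.exists_generates {F : Set (Finset ℕ)} {L : Set ℕ} (hL : L.Infinite)
    {y : Finset ℕ → X} {C : ℝ} (hC : ∀ s ∈ restr F L, ‖y s‖ ≤ C) {E : Type*}
    [SeminormedAddCommGroup E] [NormedSpace ℝ E] {u : Module.Basis ℕ ℝ E}
    (h : AsymptoticTo (· ∈ restr F L) y u) : ∃ N ⊆ L, N.Infinite ∧ Generates F y N u := by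
  have hthr : ∀ l : ℕ, ∃ n₀ : ℕ, ∀ k ∈ Finset.range (l + 1), ∀ a : Fin (k + 1) → ℝ,
      (∀ j, a j ∈ Set.Icc (-1 : ℝ) 1) → ∀ s : Fin (k + 1) → Finset ℕ,
      (∀ j, s j ∈ restr F L) → IsPlegma s → (∀ j, ∀ m ∈ s j, n₀ ≤ m) →
      |‖∑ j, a j • y (s j)‖ - ‖∑ j : Fin (k + 1), a j • u (j : ℕ)‖| ≤ 1 / ((l : ℝ) + 1) := by
    intro l
    refine Eventually.exists (f := atTop) ?_
    rw [Finset.eventually_all]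
    intro k _
    exact h.uniform hC (k + 1) Nat.one_div_pos_of_nat
  choose thr hthr using hthr
  obtain ⟨g, hg, hgQ⟩ := exists_strictMono_diagonal (fun j _ m => m ∈ L ∧ thr j ≤ m)
    (fun _ _ _ _ _ h => h) (fun j _ =>
      (Nat.frequently_atTop_iff_infinite.2 hL).and_eventually (eventually_ge_atTop _))
  have hsub : Set.range g ⊆ L := by
    rintro _ ⟨j, rfl⟩
    exact (hgQ j).1
  refine ⟨Set.range g, hsub, Set.infinite_range_of_injective hg.injective,
    fun l => 1 / ((l : ℝ) + 1), fun l => Nat.one_div_pos_of_nat,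
    tendsto_one_div_add_atTop_nhds_zero_nat, fun l k hkl a ha s hs hpl hmin => ?_⟩
  rw [elt_range hg] at hmin
  exact hthr l k (Finset.mem_range.2 (by omega)) a ha s
    (fun j => ⟨(hs j).1, (hs j).2.trans hsub⟩) hpl
    fun j m hm => (hgQ l).2.trans (hpl.le_of_le_elt hmin j hm)

theorem Generates.asymptoticTo {F : Set (Finset ℕ)} {L : Set ℕ} {y : Finset ℕ → X} {E : Type*}
    [SeminormedAddCommGroup E] [NormedSpace ℝ E] {u : Module.Basis ℕ ℝ E}
    (h : Generates F y L u) : AsymptoticTo (· ∈ restr F L) y u := by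
  obtain ⟨δ, -, hδ, hgen⟩ := h
  intro l a ε hε
  rcases l with _ | k
  · exact ⟨0, fun s _ _ _ => by simpa using hε.le⟩
  -- Dividing by `c` brings the coefficients into `[-1, 1]`; the summand 1 keeps `c` positive.
  set c := 1 + ∑ j, |a j| with hc
  have hc0 : 0 < c := by
    have : 0 ≤ ∑ j, |a j| := Finset.sum_nonneg fun _ _ => abs_nonneg _
    linarith
  obtain ⟨l, hl1, hl2⟩ := ((hδ.eventually (gt_mem_nhds (div_pos hε hc0))).and
    (eventually_ge_atTop k)).exists
  refine ⟨elt L l, fun s hs hpl hmin => ?_⟩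
  have h1 := hgen l k hl2 (fun j => c⁻¹ * a j) (fun j => by
    rw [Set.mem_Icc, ← abs_le, abs_mul, abs_of_pos (inv_pos.2 hc0), inv_mul_le_iff₀ hc0, mul_one]
    have := Finset.single_le_sum (f := fun j => |a j|) (fun _ _ => abs_nonneg _)
      (Finset.mem_univ j)
    linarith) s hs hpl (hmin 0 _ (elt_mem (Finset.card_pos.2 (hpl.nonempty 0))))
  simp only [mul_smul, ← Finset.smul_sum, norm_smul, Real.norm_eq_abs] at h1
  rw [← mul_sub, abs_mul, abs_abs, abs_of_pos (inv_pos.2 hc0), inv_mul_le_iff₀ hc0] at h1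
  refine h1.trans ?_
  rw [lt_div_iff₀ hc0] at hl1
  linarith


/-! ### Weak continuity -/

theorem mem_nhds_finsetTopology {s : Finset ℕ} {U : Set (Finset ℕ)} :
    U ∈ @nhds _ finsetTopology s ↔ ∃ n, ∀ t : Finset ℕ, (∀ m < n, m ∈ t ↔ m ∈ s) → t ∈ U := by
  rw [@nhds_induced _ _ _ charFun s, mem_comap]
  constructor
  · rintro ⟨V, hV, hVU⟩
    obtain ⟨V', hV'V, hV'o, hsV'⟩ := mem_nhds_iff.1 hV
    obtain ⟨I, u, hu, hIu⟩ := isOpen_pi_iff.1 hV'o _ hsV'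
    refine ⟨I.sup id + 1, fun t ht => hVU (hV'V (hIu fun i hi => ?_))⟩
    have h1 : i < I.sup id + 1 := Nat.lt_succ_of_le (Finset.le_sup (f := id) hi)
    have h2 : charFun t i = charFun s i := by
      simp only [charFun, ht i h1]
    rw [h2]
    exact (hu i hi).2
  · rintro ⟨n, hn⟩
    refine ⟨(Set.Iio n).pi fun i => {charFun s i},
      set_pi_mem_nhds (Set.finite_Iio n) fun i _ => by simp, fun t ht => hn t fun m hm => ?_⟩
    have : charFun t m = charFun s m := ht m hm
    simpa [charFun] using this

theorem continuousOn_toWeakSpace_iff {φ : Finset ℕ → X} {A : Set (Finset ℕ)} :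
    @ContinuousOn _ _ finsetTopology _ (fun s => toWeakSpace ℝ X (φ s)) A ↔
      ∀ s ∈ A, ∀ f : X →L[ℝ] ℝ, ∀ ε > 0, ∃ n, ∀ t ∈ A, (∀ m < n, m ∈ t ↔ m ∈ s) →
        |f (φ t) - f (φ s)| < ε := by
  let _ := finsetTopology
  have hinj : Function.Injective (topDualPairing ℝ X).flip := by
    intro x y hxy
    rw [← sub_eq_zero]
    apply SeparatingDual.eq_zero_of_forall_dual_eq_zero (R := ℝ)
    intro f
    have := LinearMap.congr_fun hxy f
    rw [map_sub, sub_eq_zero]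
    exact this
  refine forall₂_congr fun s _ => ?_
  have key : ContinuousWithinAt (fun s => toWeakSpace ℝ X (φ s)) A s ↔
      ∀ f : X →L[ℝ] ℝ, Tendsto (fun t => f (φ t)) (𝓝[A] s) (𝓝 (f (φ s))) :=
    WeakBilin.tendsto_iff_forall_eval_tendsto (B := (topDualPairing ℝ X).flip) hinj
  rw [key]
  refine forall_congr' fun f => ?_
  rw [Metric.tendsto_nhds]
  refine forall₂_congr fun ε _ => ?_
  rw [eventually_nhdsWithin_iff, Filter.Eventually, mem_nhds_finsetTopology]
  simp only [Set.mem_ofPred_eq, Real.dist_eq]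
  exact exists_congr fun n => forall_congr' fun t => ⟨fun h h1 h2 => h h2 h1, fun h h1 h2 => h h2 h1⟩

/-! ### Trees from regular families -/

/-- One-point extensions in `R` of finite subsets of the range of `h` can be made by any later
point of the range. -/
def SparseFor (R : Set (Finset ℕ)) (h : ℕ → ℕ) : Prop :=
  ∀ j, ∀ t ∈ (Finset.range j).powerset, t.image h ∈ R →
    (∃ x ∉ t.image h, insert x (t.image h) ∈ R) → insert (h j) (t.image h) ∈ R

theorem IsRegular.eventually_sparse {R : Set (Finset ℕ)} (hR : IsRegular R) (M : ℕ → ℕ) (j : ℕ) :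
    ∀ᶠ m in atTop, ∀ t ∈ (Finset.range j).powerset, t.image M ∈ R →
      (∃ x ∉ t.image M, insert x (t.image M) ∈ R) → insert m (t.image M) ∈ R := by
  rw [Finset.eventually_all]
  intro t _
  by_cases hx : ∃ x ∉ t.image M, insert x (t.image M) ∈ R
  · obtain ⟨x, hx1, hx2⟩ := hx
    filter_upwards [hR.eventually_insert_mem hx1 hx2] with m hm _ _
    exact hm
  · exact Eventually.of_forall fun _ _ h => absurd h hx

theorem image_congr_of_mem_powerset {j : ℕ} {M M' : ℕ → ℕ} (h : ∀ i < j, M i = M' i)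
    {t : Finset ℕ} (ht : t ∈ (Finset.range j).powerset) : t.image M' = t.image M :=
  Finset.image_congr fun a ha =>
    (h a (Finset.mem_range.1 (Finset.mem_powerset.1 ht ha))).symm

theorem StrictMono.notMem_image {h : ℕ → ℕ} (hh : StrictMono h) {s : Finset ℕ} {n : ℕ}
    (hn : ∀ a ∈ s, a < n) : h n ∉ s.image h := by
  intro hm
  obtain ⟨a, ha, hae⟩ := Finset.mem_image.1 hm
  have := hn a ha
  have := hh.injective hae
  omega

namespace IsRegular

variable {R : Set (Finset ℕ)}

/-- The tree of the finite sets whose image under a sparse map lies in a regular family. -/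
noncomputable def tree (hR : IsRegular R) (hx : ∃ x, {x} ∈ R) {h : ℕ → ℕ} (hh : StrictMono h)
    (hsp : SparseFor R h) : RankedTree where
  R := {t | t.image h ∈ R}
  rk t := hR.rk (t.image h)
  singleton_mem n := by
    obtain ⟨x, hx⟩ := hx
    have := hsp n ∅ (Finset.empty_mem_powerset _)
      (by simpa using hR.hereditary _ hx ∅ (Finset.empty_subset _)) ⟨x, by simpa using hx⟩
    simpa using this
  hereditary s hs t hts := hR.hereditary _ hs _ (Finset.image_subset_image hts)
  extend s n m hn hm hs := by
    simp only [Set.mem_ofPred_eq, Finset.image_insert] at hs ⊢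
    exact hsp m s (Finset.mem_powerset.2 fun a ha => Finset.mem_range.2 (hm a ha))
      (hR.hereditary _ hs _ (Finset.subset_insert _ _)) ⟨h n, StrictMono.notMem_image hh hn, hs⟩
  rk_lt s n hn hs := by
    simp only [Set.mem_ofPred_eq, Finset.image_insert] at hs ⊢
    exact hR.rk_lt_rk hs (Finset.ssubset_insert (StrictMono.notMem_image hh hn))

/-- Maximality concerns extension by any point, possibly outside the range of `h` or below `max`.
Sparseness converts any such extension into one by a later point of the range. -/
theorem terminal_tree_iff (hR : IsRegular R) (hx : ∃ x, {x} ∈ R) {h : ℕ → ℕ} (hh : StrictMono h)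
    (hsp : SparseFor R h) {t : Finset ℕ} :
    (hR.tree hx hh hsp).Terminal t ↔ Maximal (fun t => t ∈ R) (t.image h) := by
  rw [hR.maximal_iff]
  constructor
  · rintro ⟨h1, h2⟩
    refine ⟨h1, fun x hx1 hx2 => ?_⟩
    have hlt : ∀ a ∈ t, a < t.sup id + 1 := fun a ha =>
      Nat.lt_succ_of_le (Finset.le_sup (f := id) ha)
    refine h2 _ hlt ?_
    simp only [tree, Set.mem_ofPred_eq, Finset.image_insert]
    exact hsp _ t (Finset.mem_powerset.2 fun a ha => Finset.mem_range.2 (hlt a ha)) h1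
      ⟨x, hx1, hx2⟩
  · rintro ⟨h1, h2⟩
    refine ⟨h1, fun n hn hins => ?_⟩
    simp only [tree, Set.mem_ofPred_eq, Finset.image_insert] at hins
    exact h2 _ (StrictMono.notMem_image hh hn) hins

theorem nonempty_of_one_le_order (hR : IsRegular R) (h : 1 ≤ hR.order) : R.Nonempty := by
  by_contra hne
  have : IsEmpty R := Set.isEmpty_coe_sort.2 (Set.not_nonempty_iff_eq_empty.1 hne)
  rw [order, ciSup_of_empty] at h
  simp at h

theorem exists_singleton_mem (hR : IsRegular R) (h : 1 ≤ hR.order) : ∃ x, {x} ∈ R := by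
  have hne := hR.nonempty_of_one_le_order h
  rw [hR.order_eq_rk_empty hne] at h
  obtain ⟨t, ht, hlt, -⟩ := hR.exists_of_lt_rk (hR.empty_mem hne) (zero_lt_one.trans_le h)
  obtain ⟨x, hxt, -⟩ := Finset.exists_of_ssubset hlt
  exact ⟨x, hR.hereditary _ ht _ (Finset.singleton_subset_iff.2 hxt)⟩

/-- A regular family whose order bounds the ranks of countably many trees contains their images
under a sparse map, up to finitely many coordinates. -/
theorem exists_sparse_image_mem (hR : IsRegular R) (hne : R.Nonempty) (V : ℕ → RankedTree)
    (hV : ∀ k, (V k).rk ∅ ≤ hR.order) :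
    ∃ L : ℕ → ℕ, StrictMono L ∧ SparseFor R L ∧
      ∀ k t, (∀ a ∈ t, k ≤ a) → t ∈ (V k).R → t.image L ∈ R := by
  -- At stage `j` only the trees with `k ≤ j` are served, which is why the conclusion requires the
  -- elements of `t` to be at least `k`.
  obtain ⟨L, hL, hQ⟩ := exists_strictMono_diagonal
    (fun j M m => (∀ t ∈ (Finset.range j).powerset, t.image M ∈ R →
        (∃ x ∉ t.image M, insert x (t.image M) ∈ R) → insert m (t.image M) ∈ R) ∧
      ∀ k ∈ Finset.range (j + 1), ∀ t ∈ (Finset.range j).powerset, insert j t ∈ (V k).R →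
        t.image M ∈ R → (V k).rk t ≤ hR.rk (t.image M) →
        insert m (t.image M) ∈ R ∧ (V k).rk (insert j t) ≤ hR.rk (insert m (t.image M)))
    (fun j M M' m h hQ => by
      constructor
      · intro t ht
        rw [image_congr_of_mem_powerset h ht]
        exact hQ.1 t ht
      · intro k hk t ht
        rw [image_congr_of_mem_powerset h ht]
        exact hQ.2 k hk t ht)
    (fun j M => by
      refine Eventually.frequently ((hR.eventually_sparse M j).and ?_)
      rw [Finset.eventually_all]
      intro k _
      rw [Finset.eventually_all]
      intro t ht
      by_cases hc : insert j t ∈ (V k).R ∧ t.image M ∈ R ∧ (V k).rk t ≤ hR.rk (t.image M)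
      · obtain ⟨h1, h2, h3⟩ := hc
        have hlt := (V k).rk_lt t j
          (fun a ha => Finset.mem_range.1 (Finset.mem_powerset.1 ht ha)) h1
        filter_upwards [hR.eventually_le_rk_insert h2 (hlt.trans_le h3)] with m hm _ _ _
        exact hm
      · exact Eventually.of_forall fun _ h1 h2 h3 => absurd ⟨h1, h2, h3⟩ hc)
  refine ⟨L, hL, fun j => (hQ j).1, fun k t => ?_⟩
  -- The rank inequality is carried along: it guarantees that the image still has enough rank to be
  -- extended.
  suffices H : (∀ a ∈ t, k ≤ a) → t ∈ (V k).R →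
      t.image L ∈ R ∧ (V k).rk t ≤ hR.rk (t.image L) from fun h1 h2 => (H h1 h2).1
  induction t using Finset.induction_on_max with
  | empty =>
    intro _ _
    rw [Finset.image_empty, ← hR.order_eq_rk_empty hne]
    exact ⟨hR.empty_mem hne, hV k⟩
  | insert j t hj ih =>
    intro h1 h2
    obtain ⟨h3, h4⟩ := ih (fun a ha => h1 a (Finset.mem_insert_of_mem ha))
      ((V k).hereditary _ h2 _ (Finset.subset_insert _ _))
    rw [Finset.image_insert]
    exact (hQ j).2 k (Finset.mem_range.2 (Nat.lt_succ_of_le (h1 j (Finset.mem_insert_self _ _)))) t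
      (Finset.mem_powerset.2 fun a ha => Finset.mem_range.2 (hj a ha)) h2 h3 h4

end IsRegular

theorem isPlegma_const {s : Finset ℕ} (hs : s.Nonempty) : IsPlegma fun _ : Fin 1 => s where
  nonempty _ := hs
  lt_same i j hij := absurd hij (by omega)
  lt_succ _ _ k _ hk := elt_lt_elt (Nat.lt_succ_self k) hk

theorem AsymptoticTo.comap {W : WeakSystem X} {E : Type*} [SeminormedAddCommGroup E]
    [NormedSpace ℝ E] {u : ℕ → E} (h : AsymptoticTo W.Terminal W.φ u) {M : ℕ → ℕ}
    (hM : StrictMono M) : AsymptoticTo (W.comap M hM).Terminal (W.comap M hM).φ u := by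
  intro l a ε hε
  obtain ⟨n₀, hn₀⟩ := h l a ε hε
  refine ⟨n₀, fun s hs hpl hmin => hn₀ (fun j => (s j).image M)
    (fun j => (W.toRankedTree.terminal_comap_iff hM).1 (hs j)) ((isPlegma_image_iff hM).2 hpl)
    fun j m hm => ?_⟩
  obtain ⟨b, hb, rfl⟩ := Finset.mem_image.1 hm
  exact (hmin j b hb).trans hM.le_apply

/-- The tree is pulled back along a sparse sequence inside `L`, so that terminal nodes correspond to
members of `F` and the given weakly continuous extension supplies the map. -/
theorem MemSM.exists_weakSystem {ξ : Ordinal.{0}} (hξ : 1 ≤ ξ) {E : Type*}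
    [SeminormedAddCommGroup E] [NormedSpace ℝ E] {e : Module.Basis ℕ ℝ E} (he : ‖e 0‖ = 1)
    (hmem : MemSM ξ X e) :
    ∃ W : WeakSystem X, W.rk ∅ ≤ ξ ∧ W.φ ∅ = 0 ∧ (∀ t ∈ W.R, ‖W.φ t‖ ≤ 2) ∧
      AsymptoticTo W.Terminal W.φ e := by
  obtain ⟨F, x, L, ⟨R, hR, hF, hord⟩, hL, ⟨φ, hφ, hxφ⟩, hnull, hgen⟩ := hmem
  have hgen' := hgen.asymptoticTo
  have hord1 : 1 ≤ hR.order := hord ▸ hξ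
  have hx := hR.exists_singleton_mem hord1
  have hne := hR.nonempty_of_one_le_order hord1
  have hhat : hat F = R := by rw [hF, hR.hat_maximal]
  rw [hhat, continuousOn_toWeakSpace_iff] at hφ
  -- Tolerance 1 for one-term families: beyond `n₁` the vectors have norm at most `‖e 0‖ + 1 = 2`.
  obtain ⟨n₁, hn₁⟩ := hgen' 1 (fun _ => 1) 1 one_pos
  obtain ⟨h, hh, hQ⟩ := exists_strictMono_diagonal
    (fun j M m => m ∈ L ∧ n₁ ≤ m ∧ ∀ t ∈ (Finset.range j).powerset, t.image M ∈ R →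
        (∃ x ∉ t.image M, insert x (t.image M) ∈ R) → insert m (t.image M) ∈ R)
    (fun j M M' m h hQ => ⟨hQ.1, hQ.2.1, fun t ht => by
      rw [image_congr_of_mem_powerset h ht]
      exact hQ.2.2 t ht⟩)
    (fun j M => (Nat.frequently_atTop_iff_infinite.2 hL).and_eventually
      ((eventually_ge_atTop n₁).and (hR.eventually_sparse M j)))
  have hsp : SparseFor R h := fun j => (hQ j).2.2
  have himL : ∀ t : Finset ℕ, ((t.image h : Finset ℕ) : Set ℕ) ⊆ L := fun t a ha => by
    obtain ⟨b, -, rfl⟩ := Finset.mem_image.1 ha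
    exact (hQ b).1
  let W : WeakSystem X :=
    { hR.tree hx hh hsp with
      φ := fun t => φ (t.image h)
      cont := fun s hs f ε hε => by
        obtain ⟨n, hn⟩ := hφ _ ⟨hs, himL s⟩ f ε hε
        refine ⟨n, fun t ht hts => hn _ ⟨ht, himL t⟩ fun m hm => ?_⟩
        simp only [Finset.mem_image]
        constructor
        · rintro ⟨a, ha, rfl⟩
          exact ⟨a, (hts a (hh.le_apply.trans_lt hm)).1 ha, rfl⟩
        · rintro ⟨a, ha, rfl⟩
          exact ⟨a, (hts a (hh.le_apply.trans_lt hm)).2 ha, rfl⟩ }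
  have hterm : ∀ t, W.Terminal t → t.image h ∈ restr F L := fun t ht =>
    ⟨by rw [hF]; exact (hR.terminal_tree_iff hx hh hsp).1 ht, himL t⟩
  have hWφ : ∀ t, W.Terminal t → W.φ t = x (t.image h) := fun t ht =>
    (hxφ _ (hterm t ht)).symm
  refine ⟨W, ?_, ?_, ?_, ?_⟩
  · show hR.rk (Finset.image h ∅) ≤ ξ
    rw [Finset.image_empty, ← hR.order_eq_rk_empty hne, hord]
  · refine W.φ_empty_eq_zero fun f ε hε => ?_
    obtain ⟨n₀, hn₀⟩ := hnull f ε hε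
    refine ⟨n₀, fun t ht hmin => ?_⟩
    rw [hWφ t ht]
    refine hn₀ _ (hterm t ht) fun m hm => ?_
    obtain ⟨b, hb, rfl⟩ := Finset.mem_image.1 hm
    exact (hmin b hb).trans hh.le_apply
  · refine fun t ht => W.norm_le_of_terminal (by norm_num) (fun t ht => ?_) ht
    have := hn₁ (fun _ => t.image h) (fun _ => hterm t ht)
      (isPlegma_const (ht.nonempty.image h)) (fun _ m hm => by
        obtain ⟨b, -, rfl⟩ := Finset.mem_image.1 hm
        exact (hQ b).2.1)
    simp only [Fin.sum_univ_one, one_smul, Fin.val_zero, he] at this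
    rw [hWφ t ht]
    linarith [(abs_le.1 this).2]
  · intro l a ε hε
    obtain ⟨n₀, hn₀⟩ := hgen' l a ε hε
    refine ⟨n₀, fun s hs hpl hmin => ?_⟩
    simp only [hWφ _ (hs _)]
    refine hn₀ (fun j => (s j).image h) (fun j => hterm _ (hs j))
      ((isPlegma_image_iff hh).2 hpl) fun j m hm => ?_
    obtain ⟨b, hb, rfl⟩ := Finset.mem_image.1 hm
    exact (hmin j b hb).trans hh.le_apply


/-! ### The combined family generates a spreading model -/

@[simp] theorem combine_empty (V : ℕ → WeakSystem X) (d : ℕ → ℝ) : combine V d ∅ = 0 := by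
  simp [combine]

theorem sInf_congr_of_agree {t t' : Finset ℕ} {n : ℕ} (ht : t.Nonempty) (hn : ∀ a ∈ t, a < n)
    (h : ∀ m < n, m ∈ t' ↔ m ∈ t) : sInf (t' : Set ℕ) = sInf (t : Set ℕ) := by
  have h1 : sInf (t : Set ℕ) ∈ t := by
    simpa using Nat.sInf_mem (s := (t : Set ℕ)) (by simpa using ht)
  have h2 : sInf (t : Set ℕ) ∈ t' := (h _ (hn _ h1)).2 h1
  apply le_antisymm
  · exact Nat.sInf_le (by simpa using h2)
  · have h3 : sInf (t' : Set ℕ) ∈ t' := by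
      simpa using Nat.sInf_mem (s := (t' : Set ℕ)) ⟨_, by simpa using h2⟩
    have h4 : sInf (t' : Set ℕ) ≤ sInf (t : Set ℕ) := Nat.sInf_le (by simpa using h2)
    exact Nat.sInf_le (by simpa using (h _ (h4.trans_lt (hn _ h1))).1 h3)

theorem eventually_abs_sum_sub_lt (V : ℕ → WeakSystem X) {d : ℕ → ℝ} (hd : ∀ k, 0 < d k)
    (t : Finset ℕ) (f : X →L[ℝ] ℝ) {ε : ℝ} (hε : 0 < ε) (N : ℕ) :
    ∃ n, ∀ t' : Finset ℕ, (∀ m < n, m ∈ t' ↔ m ∈ t) →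
      |f (∑ k ∈ Finset.range N, d k • (V k).φ ((V k).trunc t')) -
        f (∑ k ∈ Finset.range N, d k • (V k).φ ((V k).trunc t))| < ε := by
  set S := ∑ k ∈ Finset.range N, d k with hS
  have hS0 : 0 ≤ S := Finset.sum_nonneg fun k _ => (hd k).le
  choose n hn using fun k => (V k).cont _ ((V k).trunc_mem t) f (ε / (S + 1)) (by positivity)
  refine ⟨∑ k ∈ Finset.range N, n k, fun t' h => ?_⟩
  rw [map_sum, map_sum, ← Finset.sum_sub_distrib]
  have h1 : ∀ k ∈ Finset.range N, |f (d k • (V k).φ ((V k).trunc t')) -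
      f (d k • (V k).φ ((V k).trunc t))| ≤ d k * (ε / (S + 1)) := by
    intro k hk
    rw [map_smul, map_smul, smul_eq_mul, smul_eq_mul, ← mul_sub, abs_mul, abs_of_pos (hd k)]
    refine mul_le_mul_of_nonneg_left (hn k _ ((V k).trunc_mem t') ?_).le (hd k).le
    have hnk : n k ≤ ∑ k ∈ Finset.range N, n k :=
      Finset.single_le_sum (f := n) (fun _ _ => Nat.zero_le _) hk
    exact fun m hm => (V k).trunc_congr (n := n k) (fun m hm => h m (hm.trans_le hnk)) m hm
  refine (Finset.abs_sum_le_sum_abs _ _).trans_lt ((Finset.sum_le_sum h1).trans_lt ?_)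
  rw [← Finset.sum_mul, ← hS]
  calc S * (ε / (S + 1)) < (S + 1) * (ε / (S + 1)) := by gcongr; linarith
    _ = ε := by field_simp

/-- Near a nonempty set the minimum, hence the number of summands, is fixed. Near `∅` this number is
unbounded; there the tail of `d` is small, and the finitely many other summands tend weakly to 0. -/
theorem combine_weakly_continuous {V : ℕ → WeakSystem X} (hV0 : ∀ k, (V k).φ ∅ = 0) {C : ℝ}
    (hC : ∀ k, ∀ t ∈ (V k).R, ‖(V k).φ t‖ ≤ C) {d : ℕ → ℝ} (hd : ∀ k, 0 < d k)
    (hsum : Summable d) (t : Finset ℕ) (f : X →L[ℝ] ℝ) {ε : ℝ} (hε : 0 < ε) :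
    ∃ n, ∀ t' : Finset ℕ, (∀ m < n, m ∈ t' ↔ m ∈ t) →
      |f (combine V d t') - f (combine V d t)| < ε := by
  rcases t.eq_empty_or_nonempty with rfl | ht
  · have hC0 : 0 ≤ C := (norm_nonneg _).trans (hC 0 ∅ (V 0).empty_mem)
    obtain ⟨N, -, hN⟩ := exists_sum_Ico_le hd hsum
      (show 0 < ε / (2 * (‖f‖ + 1) * (C + 1)) by positivity) 0
    obtain ⟨n, hn⟩ := eventually_abs_sum_sub_lt V hd ∅ f (half_pos hε) N
    have htr : ∀ k, (V k).trunc ∅ = ∅ := fun k =>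
      Finset.subset_empty.1 ((V k).trunc_subset ∅)
    refine ⟨max n N, fun t' h => ?_⟩
    rw [combine_empty, map_zero, sub_zero]
    rcases t'.eq_empty_or_nonempty with rfl | ht'
    · simpa using hε
    have hNle : N ≤ sInf (t' : Set ℕ) := le_sInf_of_forall ht' fun m hm => by
      by_contra! hlt
      simpa using (h m (hlt.trans_le (le_max_right _ _))).1 hm
    have h1 := hn t' fun m hm => h m (hm.trans_le (le_max_left _ _))
    simp only [htr, hV0, smul_zero, Finset.sum_const_zero, map_zero, sub_zero] at h1
    rw [combine, ← Finset.sum_range_add_sum_Ico _ hNle, map_add]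
    have h2 : ‖∑ k ∈ Finset.Ico N (sInf (t' : Set ℕ)), d k • (V k).φ ((V k).trunc t')‖ ≤
        ε / (2 * (‖f‖ + 1) * (C + 1)) * C := by
      refine (norm_sum_le _ _).trans ?_
      calc ∑ k ∈ Finset.Ico N (sInf (t' : Set ℕ)), ‖d k • (V k).φ ((V k).trunc t')‖
          ≤ ∑ k ∈ Finset.Ico N (sInf (t' : Set ℕ)), d k * C := by
            refine Finset.sum_le_sum fun k _ => ?_
            rw [norm_smul, Real.norm_eq_abs, abs_of_pos (hd k)]
            exact mul_le_mul_of_nonneg_left (hC k _ ((V k).trunc_mem _)) (hd k).le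
        _ ≤ _ := by
            rw [← Finset.sum_mul]
            exact mul_le_mul_of_nonneg_right (hN _) hC0
    have h3 : |f (∑ k ∈ Finset.Ico N (sInf (t' : Set ℕ)), d k • (V k).φ ((V k).trunc t'))| ≤
        ε / 2 := by
      refine (f.le_opNorm _).trans ?_
      calc _ ≤ (‖f‖ + 1) * (ε / (2 * (‖f‖ + 1) * (C + 1)) * (C + 1)) := by
            refine mul_le_mul (by linarith) (h2.trans ?_) (norm_nonneg _) (by positivity)
            gcongr
            linarith
        _ = ε / 2 := by field_simp
    exact (abs_add_le _ _).trans_lt (by linarith)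
  · obtain ⟨n, hn⟩ := eventually_abs_sum_sub_lt V hd t f hε (sInf (t : Set ℕ))
    refine ⟨max n (t.sup id + 1), fun t' h => ?_⟩
    have hs := sInf_congr_of_agree ht (fun a ha =>
      (Nat.lt_succ_of_le (Finset.le_sup (f := id) ha)).trans_le (le_max_right _ _)) h
    rw [combine, combine, hs]
    exact hn t' fun m hm => h m (hm.trans_le (le_max_left _ _))

/-- The preimage of a finite set under a strictly increasing map. -/
noncomputable def pullSet {L : ℕ → ℕ} (hL : StrictMono L) (s : Finset ℕ) : Finset ℕ :=
  s.preimage L hL.injective.injOn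

theorem image_pullSet {L : ℕ → ℕ} (hL : StrictMono L) {s : Finset ℕ}
    (hs : (s : Set ℕ) ⊆ Set.range L) : (pullSet hL s).image L = s := by
  ext a
  simp only [pullSet, Finset.mem_image, Finset.mem_preimage]
  constructor
  · rintro ⟨b, hb, rfl⟩
    exact hb
  · intro ha
    obtain ⟨b, rfl⟩ := hs ha
    exact ⟨b, ha, rfl⟩

theorem mem_pullSet {L : ℕ → ℕ} (hL : StrictMono L) {s : Finset ℕ} {m : ℕ} :
    m ∈ pullSet hL s ↔ L m ∈ s := by
  simp [pullSet]

/-! ### Transfer to the maximal sets of one regular family. -/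

section Target

variable {S : Set (Finset ℕ)} {V : ℕ → WeakSystem X} {L : ℕ → ℕ}

/-- If an entire pulled-back set lay in the `k`-th tree and had a later extension there, the image
of the extension would lie in `S`, against maximality. -/
theorem admissible_pullSet (hS : IsRegular S) (hx : ∃ x, {x} ∈ S) (hL : StrictMono L)
    (hVL : ∀ k t, (∀ a ∈ t, k ≤ a) → t ∈ (V k).R → t.image L ∈ S) {s : Finset ℕ}
    (hs : s ∈ restr {s | Maximal (fun t => t ∈ S) s} (Set.range L)) :
    Admissible V (pullSet hL s) := by
  intro k hk
  apply (V k).terminal_trunc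
  intro ht
  refine ⟨ht, fun n hn hins => ?_⟩
  have him := image_pullSet hL hs.2
  have hmax := hS.maximal_iff.1 hs.1
  have hne : (pullSet hL s).Nonempty := by
    rw [Finset.nonempty_iff_ne_empty]
    intro h
    rw [h, Finset.image_empty] at him
    obtain ⟨x, hx⟩ := hx
    exact hmax.2 x (by simp [← him]) (by simpa [← him] using hx)
  obtain ⟨b, hb⟩ := hne
  have h1 := hVL k _ (fun a ha => by
    rcases Finset.mem_insert.1 ha with rfl | h
    · exact (hk b hb).trans (hn b hb).le
    · exact hk a h) hins
  rw [Finset.image_insert, him] at h1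
  refine hmax.2 (L n) (fun hmem => ?_) h1
  exact (hn n ((mem_pullSet hL).2 hmem)).false

theorem isPlegma_pullSet (hL : StrictMono L) {l : ℕ} {s : Fin l → Finset ℕ} (hs : IsPlegma s)
    (hsL : ∀ j, (s j : Set ℕ) ⊆ Set.range L) : IsPlegma fun j => pullSet hL (s j) := by
  rw [← isPlegma_image_iff hL]
  simp only [image_pullSet hL (hsL _)]
  exact hs

theorem exists_plegma_maximal (hS : IsRegular S) (hx : ∃ x, {x} ∈ S) (hL : StrictMono L)
    (hsp : SparseFor S L) (l n : ℕ) : ∃ s : Fin l → Finset ℕ,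
      (∀ j, s j ∈ restr {s | Maximal (fun t => t ∈ S) s} (Set.range L)) ∧ IsPlegma s ∧
      ∀ j, ∀ m ∈ s j, n ≤ m := by
  let T := hS.tree hx hL hsp
  let p : ℕ → ℕ := fun i => n + i
  have hp : StrictMono p := fun i j hij => Nat.add_lt_add_left hij n
  have hst : ∀ j : Fin l, StrictMono (strand l j p) := fun j => strictMono_strand j.pos _ hp
  refine ⟨fun j => (T.top (strand l j p)).image L, fun j => ⟨?_, ?_⟩, ?_, fun j m hm => ?_⟩
  · exact (hS.terminal_tree_iff hx hL hsp).1 (T.terminal_top (hst j))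
  · intro a ha
    obtain ⟨b, -, rfl⟩ := Finset.mem_image.1 ha
    exact ⟨b, rfl⟩
  · refine (isPlegma_image_iff hL).2 (isPlegma_init hst (fun j => T.cut_pos (hst j))
      (fun i j hij k => hp (Nat.add_lt_add_left hij _)) (fun i j k => hp ?_))
    have := i.2
    rw [add_mul]
    omega
  · obtain ⟨b, hb, rfl⟩ := Finset.mem_image.1 hm
    obtain ⟨i, -, rfl⟩ := mem_init.1 hb
    exact (Nat.le_add_right n _).trans hL.le_apply

end Target

theorem norm_sum_smul_smul {E : Type*} [SeminormedAddCommGroup E] [NormedSpace ℝ E] {l : ℕ}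
    (a : Fin l → ℝ) {c : ℝ} (hc : 0 ≤ c) (v : Fin l → E) :
    ‖∑ j, a j • c • v j‖ = c * ‖∑ j, a j • v j‖ := by
  rw [← norm_sum_mul_smul a hc]
  simp only [mul_smul]

theorem AsymptoticTo.const_smul {P : Finset ℕ → Prop} {y : Finset ℕ → X} {E : Type*}
    [SeminormedAddCommGroup E] [NormedSpace ℝ E] {u : ℕ → E} (h : AsymptoticTo P y u) {c : ℝ}
    (hc : 0 < c) : AsymptoticTo P (fun s => c • y s) fun n => c • u n := by
  intro l a ε hε
  obtain ⟨n₀, hn₀⟩ := h l a (ε / c) (div_pos hε hc)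
  refine ⟨n₀, fun s h1 h2 h3 => ?_⟩
  have := hn₀ s h1 h2 h3
  rw [le_div_iff₀ hc] at this
  rw [norm_sum_smul_smul a hc.le, norm_sum_smul_smul a hc.le (fun j : Fin l => u j), ← mul_sub,
    abs_mul, abs_of_pos hc, mul_comm]
  exact this

/-- Each member of a plegma family is by itself a one-term plegma family, so all basis vectors have
the same limiting norm. -/
theorem AsymptoticTo.norm_eq {P : Finset ℕ → Prop} {y : Finset ℕ → X} {E : Type*}
    [SeminormedAddCommGroup E] [NormedSpace ℝ E] {u : ℕ → E} (h : AsymptoticTo P y u)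
    (hex : ∀ l n : ℕ, ∃ s : Fin l → Finset ℕ, (∀ j, P (s j)) ∧ IsPlegma s ∧
      ∀ j, ∀ m ∈ s j, n ≤ m) (n : ℕ) : ‖u n‖ = ‖u 0‖ := by
  apply eq_of_abs_sub_le_all
  intro ε hε
  let i : Fin (n + 1) := Fin.last n
  obtain ⟨n₁, h1⟩ := h (n + 1) (Pi.single i 1) (ε / 2) (half_pos hε)
  obtain ⟨n₂, h2⟩ := h 1 (fun _ => 1) (ε / 2) (half_pos hε)
  obtain ⟨s, hsP, hpl, hs⟩ := hex (n + 1) (max n₁ n₂)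
  have e1 := h1 s hsP hpl fun j m hm => (le_max_left _ _).trans (hs j m hm)
  have e2 := h2 (fun _ => s i) (fun _ => hsP i) (isPlegma_const (hpl.nonempty i))
    fun _ m hm => (le_max_right _ _).trans (hs i m hm)
  simp only [Pi.single_apply, ite_smul, one_smul, zero_smul, Finset.sum_ite_eq',
    Finset.mem_univ, if_true] at e1
  simp only [Fin.sum_univ_one, one_smul, Fin.val_zero] at e2
  have hi : (i : ℕ) = n := Fin.val_last n
  rw [hi] at e1
  rw [abs_le] at *
  constructor <;> linarith [e1.1, e1.2, e2.1, e2.2]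

theorem summable_mul_norm_sum {E : ℕ → Type*} [∀ k, SeminormedAddCommGroup (E k)]
    [∀ k, NormedSpace ℝ (E k)] {e : ∀ k, ℕ → E k} (he : ∀ k n, ‖e k n‖ = 1) {d : ℕ → ℝ}
    (hd : ∀ k, 0 < d k) (hsum : Summable d) {l : ℕ} (a : Fin l → ℝ) :
    Summable fun k => d k * ‖∑ j : Fin l, a j • e k j‖ := by
  refine Summable.of_nonneg_of_le (fun k => mul_nonneg (hd k).le (norm_nonneg _)) (fun k => ?_)
    (hsum.mul_right (∑ j, |a j|))
  refine mul_le_mul_of_nonneg_left ((norm_sum_le _ _).trans (Finset.sum_le_sum fun j _ => ?_))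
    (hd k).le
  rw [norm_smul, he, mul_one, Real.norm_eq_abs]

/-- A common bound for countably many spreading models: the combination with coefficients `d k`
of the families generating `e k` generates a spreading model that dominates all of them. -/
theorem exists_combined_spreadingModel {ξ : Ordinal.{0}} (hξ : 1 ≤ ξ) {d : ℕ → ℝ}
    (hd : ∀ k, 0 < d k) (hsum : Summable d) {E : ℕ → Type*} [∀ k, SeminormedAddCommGroup (E k)]
    [∀ k, NormedSpace ℝ (E k)] (e : ∀ k, Module.Basis ℕ ℝ (E k)) (he : ∀ k n, ‖e k n‖ = 1)
    (hmem : ∀ k, MemSM ξ X (e k)) :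
    ∃ (F : Set (Finset ℕ)) (y : Finset ℕ → X) (L : Set ℕ) (C : ℝ),
      IsRegularThinOfOrder F ξ ∧ L.Infinite ∧ (∀ s, ‖y s‖ ≤ C) ∧
      (∀ l n : ℕ, ∃ s : Fin l → Finset ℕ, (∀ j, s j ∈ restr F L) ∧ IsPlegma s ∧
        ∀ j, ∀ m ∈ s j, n ≤ m) ∧
      (∀ N ⊆ L, IsSubordinated F y N ∧ IsWeaklyNull F y N) ∧
      ∃ (E' : Type) (_ : SeminormedAddCommGroup E') (_ : NormedSpace ℝ E')
        (u : Module.Basis ℕ ℝ E'), AsymptoticTo (· ∈ restr F L) y u ∧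
        ∀ (l : ℕ) (a : Fin l → ℝ), (∀ k, d k * ‖∑ j : Fin l, a j • e k j‖ ≤
            ‖∑ j : Fin l, a j • u j‖) ∧
          ‖∑ j : Fin l, a j • u j‖ ≤ ∑' k, d k * ‖∑ j : Fin l, a j • e k j‖ := by
  choose W₀ hrk hφ₀ hbd₀ has₀ using fun k => (hmem k).exists_weakSystem hξ (he k 0)
  obtain ⟨M, hM, hst⟩ := exists_stable hbd₀
  set W : ℕ → WeakSystem X := fun k => (W₀ k).comap M hM with hWdef
  have hbd : ∀ k, ∀ t ∈ (W k).R, ‖(W k).φ t‖ ≤ 2 := fun k t ht => hbd₀ k _ ht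
  have hφ : ∀ k, (W k).φ ∅ = 0 := fun k => hφ₀ k
  have has : ∀ k, AsymptoticTo (W k).Terminal (W k).φ (e k) := fun k => (has₀ k).comap hM
  set V := interlaced W with hV
  have hVφ : ∀ k, (V k).φ ∅ = 0 := hφ
  have hVbd := interlaced_bound hbd
  -- Only some regular family of order `ξ` is needed as common index set; the one behind `e 0` is
  -- used.
  obtain ⟨F, -, -, ⟨S, hS, hF, hord⟩, -⟩ := hmem 0
  have hord1 : 1 ≤ hS.order := hord ▸ hξ
  have hx := hS.exists_singleton_mem hord1
  obtain ⟨L, hL, hsp, hVL⟩ := hS.exists_sparse_image_mem (hS.nonempty_of_one_le_order hord1)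
    (fun k => (V k).toRankedTree) (fun k => (hrk k).trans_eq hord.symm)
  subst hF
  set F := {s | Maximal (fun t => t ∈ S) s} with hFdef
  set y : Finset ℕ → X := fun s => combine V d (pullSet hL s) with hy
  have hex := exists_plegma_maximal hS hx hL hsp
  have hadm : ∀ s ∈ restr F (Set.range L), Admissible V (pullSet hL s) := fun s hs =>
    admissible_pullSet hS hx hL hVL hs
  have hfar : ∀ {s : Finset ℕ} {n : ℕ}, (∀ m ∈ s, L n ≤ m) → ∀ m ∈ pullSet hL s, n ≤ m :=
    fun h m hm => hL.le_iff_le.1 (h _ ((mem_pullSet hL).1 hm))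
  have hcont : ∀ s : Finset ℕ, ∀ f : X →L[ℝ] ℝ, ∀ ε > 0, ∃ n, ∀ t : Finset ℕ,
      (∀ m < n, m ∈ t ↔ m ∈ s) → |f (y t) - f (y s)| < ε := by
    intro s f ε hε
    obtain ⟨n, hn⟩ := combine_weakly_continuous hVφ hVbd hd hsum (pullSet hL s) f hε
    refine ⟨L n, fun t ht => hn _ fun m hm => ?_⟩
    rw [mem_pullSet, mem_pullSet]
    exact ht _ (hL hm)
  have hcauchy : ∀ (l : ℕ) (a : Fin l → ℝ), ∀ ε > 0, ∃ n₀ : ℕ, ∀ s s' : Fin l → Finset ℕ,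
      (∀ j, s j ∈ restr F (Set.range L)) → (∀ j, s' j ∈ restr F (Set.range L)) →
      IsPlegma s → IsPlegma s' →
      (∀ j, ∀ m ∈ s j, n₀ ≤ m) → (∀ j, ∀ m ∈ s' j, n₀ ≤ m) →
      |‖∑ j, a j • y (s j)‖ - ‖∑ j, a j • y (s' j)‖| ≤ ε := by
    intro l a ε hε
    obtain ⟨n, hn⟩ := cauchy_norm_combine hst hbd hd hsum a hε
    exact ⟨L n, fun s s' hs hs' hpl hpl' h h' => hn _ _ (fun j => hadm _ (hs j))
      (fun j => hadm _ (hs' j)) (isPlegma_pullSet hL hpl fun j => (hs j).2)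
      (isPlegma_pullSet hL hpl' fun j => (hs' j).2) (fun j => hfar (h j))
      (fun j => hfar (h' j))⟩
  obtain ⟨E', i1, i2, u, hu⟩ := exists_basis_asymptoticTo hcauchy hex
  refine ⟨F, y, Set.range L, (∑' k, d k) * 2, ⟨S, hS, rfl, hord⟩,
    Set.infinite_range_of_injective hL.injective, fun s => norm_combine_le hVbd hd hsum _, hex,
    fun N hN => ⟨⟨y, continuousOn_toWeakSpace_iff.2 fun s _ f ε hε => ?_, fun _ _ => rfl⟩,
      fun f ε hε => ?_⟩, E', i1, i2, u, hu, fun l a => ⟨fun k => ?_, ?_⟩⟩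
  · obtain ⟨n, hn⟩ := hcont s f ε hε
    exact ⟨n, fun t _ h => hn t h⟩
  · obtain ⟨n, hn⟩ := hcont ∅ f ε hε
    refine ⟨n, fun s _ hs => ?_⟩
    have h0 : y ∅ = 0 := by
      simp [hy, pullSet]
    have := hn s fun m hm => by
      constructor
      · intro h
        have := hs m h
        omega
      · simp
    simpa [h0] using this
  · apply le_of_forall_pos_le_add
    intro ε hε
    -- The estimate for `u` is read off a single plegma family far enough out.
    obtain ⟨n₁, h1⟩ := hu l a (ε / 2) (half_pos hε)
    obtain ⟨n₂, h2⟩ := le_norm_combine hst hbd hφ has hd hsum a k (half_pos hε)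
    obtain ⟨s, hs, hpl, hmin⟩ := hex l (max n₁ (L n₂))
    have e1 := h1 s hs hpl fun j m hm => (le_max_left _ _).trans (hmin j m hm)
    have e2 := h2 _ (fun j => hadm _ (hs j)) (isPlegma_pullSet hL hpl fun j => (hs j).2)
      (fun j => hfar fun m hm => (le_max_right _ _).trans (hmin j m hm))
    have e3 := (abs_le.1 e1).2
    linarith
  · apply le_of_forall_pos_le_add
    intro ε hε
    obtain ⟨n₁, h1⟩ := hu l a (ε / 2) (half_pos hε)
    obtain ⟨n₂, h2⟩ := norm_combine_le_tsum hbd has hd hsum a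
      (summable_mul_norm_sum he hd hsum a) (half_pos hε)
    obtain ⟨s, hs, hpl, hmin⟩ := hex l (max n₁ (L n₂))
    have e1 := h1 s hs hpl fun j m hm => (le_max_left _ _).trans (hmin j m hm)
    have e2 := h2 _ (fun j => hadm _ (hs j)) (isPlegma_pullSet hL hpl fun j => (hs j).2)
      (fun j => hfar fun m hm => (le_max_right _ _).trans (hmin j m hm))
    have e3 := (abs_le.1 e1).1
    linarith

end HigherOrderSM

/-! ### Normalization of the combined spreading model. -/

theorem theorem19 {X : Type*} [NormedAddCommGroup X] [NormedSpace ℝ X] [CompleteSpace X]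
    (ξ : Ordinal.{0}) (hξ1 : 1 ≤ ξ) (hξ : ξ < Ordinal.omega 1)
    (c : ℕ → ℝ) (hc : ∀ k, 0 < c k) (hsum : Summable (fun k => (c k)⁻¹))
    {E : ℕ → Type*} [∀ k, SeminormedAddCommGroup (E k)] [∀ k, NormedSpace ℝ (E k)]
    (e : ∀ k, Module.Basis ℕ ℝ (E k)) (hnorm : ∀ k n, ‖e k n‖ = 1)
    (hmem : ∀ k, HigherOrderSM.MemSM ξ X (e k)) :
    ∃ (E' : Type) (_ : SeminormedAddCommGroup E') (_ : NormedSpace ℝ E')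
      (u : Module.Basis ℕ ℝ E') (K : ℝ),
      HigherOrderSM.MemSM ξ X u ∧
      (∀ k, (c k)⁻¹ ≤ K) ∧ K ≤ ∑' k, (c k)⁻¹ ∧
      (∀ n, ‖u n‖ = 1) ∧
      (∀ k, HigherOrderSM.Dominates (c k * K) u (e k)) ∧
      (∀ (l : ℕ) (a : Fin l → ℝ),
        Summable (fun k => (c k)⁻¹ * ‖∑ j : Fin l, a j • e k (j : ℕ)‖) ∧
        ‖∑ j : Fin l, a j • u (j : ℕ)‖ ≤
          K⁻¹ * ∑' k, (c k)⁻¹ * ‖∑ j : Fin l, a j • e k (j : ℕ)‖) := by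
  have hd : ∀ k, 0 < (c k)⁻¹ := fun k => inv_pos.2 (hc k)
  obtain ⟨F, y, L, C, hF, hL, hC, hex, hN, E', i1, i2, u, hu, hle⟩ :=
    HigherOrderSM.exists_combined_spreadingModel hξ1 hd hsum e hnorm hmem
  have hun := hu.norm_eq hex
  -- For a single vector with coefficient 1 the two estimates become the bounds on `K`, and in
  -- particular `K > 0`.
  have hone := hle 1 fun _ => 1
  simp only [Fin.sum_univ_one, one_smul, Fin.val_zero, hnorm, mul_one] at hone
  have hK : 0 < ‖u 0‖ := (hd 0).trans_le (hone.1 0)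
  set K := ‖u 0‖ with hKdef
  have hKi : 0 < K⁻¹ := inv_pos.2 hK
  set w : Module.Basis ℕ ℝ E' := u.unitsSMul fun _ => Units.mk0 K⁻¹ hKi.ne' with hw
  have hwu : ∀ n, w n = K⁻¹ • u n := fun n => by
    rw [hw, Module.Basis.unitsSMul_apply]
    rfl
  have hnormw : ∀ (l : ℕ) (a : Fin l → ℝ),
      ‖∑ j : Fin l, a j • w j‖ = K⁻¹ * ‖∑ j : Fin l, a j • u j‖ := fun l a => by
    simp only [hwu]
    exact HigherOrderSM.norm_sum_smul_smul a hKi.le fun j : Fin l => u j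
  have hasw : HigherOrderSM.AsymptoticTo (· ∈ HigherOrderSM.restr F L) (fun s => K⁻¹ • y s) w := by
    have := hu.const_smul hKi
    have e : (fun n => K⁻¹ • u n) = w := funext fun n => (hwu n).symm
    rwa [e] at this
  obtain ⟨N, hNL, hNinf, hgen⟩ := hasw.exists_generates hL (C := K⁻¹ * C) fun s _ => by
    rw [norm_smul, Real.norm_eq_abs, abs_of_pos hKi]
    exact mul_le_mul_of_nonneg_left (hC s) hKi.le
  obtain ⟨⟨φ, hφ, hyφ⟩, hnull⟩ := hN N hNL
  refine ⟨E', i1, i2, w, K, ⟨F, fun s => K⁻¹ • y s, N, hF, hNinf, ⟨fun s => K⁻¹ • φ s, ?_, ?_⟩,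
    ?_, hgen⟩, hone.1, hone.2, fun n => ?_, fun k n a => ?_, fun l a => ⟨?_, ?_⟩⟩
  · let _ := HigherOrderSM.finsetTopology
    simp only [map_smul]
    exact hφ.const_smul K⁻¹
  · intro s hs
    simp only [hyφ s hs]
  · intro f ε hε
    -- The tolerance `K * ε` absorbs the factor `K⁻¹` of the normalized family.
    obtain ⟨n₀, hn₀⟩ := hnull f (K * ε) (mul_pos hK hε)
    refine ⟨n₀, fun s hs hmin => ?_⟩
    simp only [map_smul, smul_eq_mul]
    rw [abs_mul, abs_of_pos hKi, inv_mul_lt_iff₀ hK]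
    exact hn₀ s hs hmin
  · rw [hwu, norm_smul, hun, Real.norm_eq_abs, abs_of_pos hKi, inv_mul_cancel₀ hK.ne']
  · rw [hnormw, mul_assoc, mul_inv_cancel_left₀ hK.ne', ← inv_mul_le_iff₀ (hc k)]
    exact (hle n a).1 k
  · exact HigherOrderSM.summable_mul_norm_sum hnorm hd hsum a
  · rw [hnormw]
    exact mul_le_mul_of_nonneg_left (hle l a).2 hKi.le
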